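/- Fix a nonzero complex number $h$ and an ordered index set $I$ with a distinguished element $0\in I$. Let $H_I$ be the unital complex algebra with generators $x_i,y_i$ ($i\in I$) and relations $$x_iy_i=y_ix_i+hy_i^2,\quad x_jy_i=y_ix_j+hy_iy_j,\quad y_jx_i=x_iy_j-hy_iy_j,\quad y_jy_i=y_iy_j,\quad x_jx_i=x_ix_j-hx_iy_j+hy_ix_j+h^2y_iy_j\qquad(i<j).$$ The quantum group $U_h(sl(2))$ acts on $H_I$ by linear operators $E,F,H$ with $E1=F1=H1=0$, $Ex_i=0$, $Ey_i=x_i$, $Fx_i=y_i$, $Fy_i=0$, $Hx_i=x_i$, $Hy_i=-y_i$ and $$E(ab)=E(a)e^{-hF}(b)+e^{hF}(a)E(b),\quad F(ab)=F(a)b+aF(b),\quad H(ab)=H(a)e^{-hF}(b)+e^{hF}(a)H(b).$$ Let $Q_I$ be the quotient skew field of $H_I$ and $Q_{I\setminus\{0\}}$ the skew subfield generated by the subalgebra $H_{I\setminus\{0\}}$ generated by the $x_i,y_i$ with $i\neq 0$. Let $Q_I^\Sigma\supseteq Q_I$ be a skew field with an extension of the action, in which $e^{hF}$ acts by an algebra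 automorphism, generated by $Q_I$ and a set $\Sigma$ of central invariant elements, each algebraic over the field $Q_{I\setminus\{0\}}^{Inv}$ of invariants of $Q_{I\setminus\{0\}}$; here $v$ is called invariant if $Ev=Fv=Hv=0$ and $e^{hF}v=v$. Let $Q_{I\setminus\{0\}}^\Sigma$ be the skew subfield generated by $Q_{I\setminus\{0\}}$ and $\Sigma$, and write $x=x_0$, $y=y_0$. An $n$-form is a nonzero invariant element $\sum_{i=0}^n\binom ni x^{n-i}y^iA_i$ of $Q_I^\Sigma$ with $A_i\in Q^\Sigma_{I\setminus\{0\}}$. We say that $X,Y\in Q^\Sigma_{I\setminus\{0\}}$ are homogeneous coordinates of a linear form if $(0X):=xY-yX-hyY$ is a $1$-form; its zero is $Z:=XY^{-1}+\frac h2$. For such $X,Y$ let $\Delta$ be the $\mathbb C$-linear derivation of $Q_I^\Sigma$ with $\Delta x=X$, $\Delta y=Y$ that vanishes on $Q^\Sigma_{I\setminus\{0\}}$, and let $P_{(x,y),(X,Y)}a=\frac1n\Delta a$ for $a$ homogeneous of degree $n\ge1$ in $x,y$ (with coefficients in $Q^\Sigma_{I\setminus\{0\}}$). Finally put $(X_iX_j):=X_iY_j-Y_iX_j-hY_iY_j$.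 **Lemma 24.** Let $k\ge 2$, let $f=(0X_1)\cdots(0X_k)$ be a $k$-form which is a product of linear forms with homogeneous coordinates $X_i,Y_i\in Q^\Sigma_{I\setminus\{0\}}$ and with different zeros, i.e. $Z_i\neq Z_j$ for $i\ne j$, where $Z_i=X_iY_i^{-1}+\frac h2$, and let $g$ be a $(k-2)$-form. Then $$\sum_{i=1}^k\frac{P^{k-2}_{(x,y),(X_i,Y_i)}\,g}{(X_iX_1)\cdots(X_iX_{i-1})(X_iX_{i+1})\cdots(X_iX_k)}=0 .$$ -/

import Mathlib

/-! ### The algebra of homogeneous coordinates -/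

/-- The free generators `x_i`, `y_i` (`i ∈ I`). -/
inductive Gen (I : Type*) : Type _
  | x (i : I) : Gen I
  | y (i : I) : Gen I

/-- The generator `x_i` of the free algebra. -/
def Gen.fx {I : Type*} (i : I) : FreeAlgebra ℂ (Gen I) := FreeAlgebra.ι ℂ (Gen.x i)

/-- The generator `y_i` of the free algebra. -/
def Gen.fy {I : Type*} (i : I) : FreeAlgebra ℂ (Gen I) := FreeAlgebra.ι ℂ (Gen.y i)

open Gen in
/-- The defining relations of `H_I`. -/
inductive HRel (h : ℂ) (I : Type*) [LinearOrder I] :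
    FreeAlgebra ℂ (Gen I) → FreeAlgebra ℂ (Gen I) → Prop
  | xy_self (i : I) : HRel h I (fx i * fy i) (fy i * fx i + h • (fy i * fy i))
  | xy (i j : I) (hij : i < j) : HRel h I (fx j * fy i) (fy i * fx j + h • (fy i * fy j))
  | yx (i j : I) (hij : i < j) : HRel h I (fy j * fx i) (fx i * fy j - h • (fy i * fy j))
  | yy (i j : I) (hij : i < j) : HRel h I (fy j * fy i) (fy i * fy j)
  | xx (i j : I) (hij : i < j) : HRel h I (fx j * fx i)
      (fx i * fx j - h • (fx i * fy j) + h • (fy i * fx j) + h ^ 2 • (fy i * fy j))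

/-- The algebra `H_I`: generators `x_i, y_i`, `i ∈ I`, and the relations `HRel`. -/
def HAlg (h : ℂ) (I : Type*) [LinearOrder I] : Type _ := RingQuot (HRel h I)

noncomputable instance (h : ℂ) (I : Type*) [LinearOrder I] : Ring (HAlg h I) :=
  inferInstanceAs (Ring (RingQuot (HRel h I)))

noncomputable instance (h : ℂ) (I : Type*) [LinearOrder I] : Algebra ℂ (HAlg h I) :=
  inferInstanceAs (Algebra ℂ (RingQuot (HRel h I)))

namespace HAlg

variable {h : ℂ} {I : Type*} [LinearOrder I]

/-- The quotient map from the free algebra onto `H_I`. -/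
noncomputable def mk (h : ℂ) (I : Type*) [LinearOrder I] :
    FreeAlgebra ℂ (Gen I) →ₐ[ℂ] HAlg h I := RingQuot.mkAlgHom ℂ (HRel h I)

/-- The coordinate `x_i ∈ H_I`. -/
noncomputable def x (i : I) : HAlg h I := mk h I (Gen.fx i)

/-- The coordinate `y_i ∈ H_I`. -/
noncomputable def y (i : I) : HAlg h I := mk h I (Gen.fy i)

theorem mk_rel {a b : FreeAlgebra ℂ (Gen I)} (r : HRel h I a b) : mk h I a = mk h I b :=
  RingQuot.mkAlgHom_rel ℂ r

theorem yy (i j : I) : (y i * y j : HAlg h I) = y j * y i := by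
  rcases lt_trichotomy i j with hij | rfl | hij
  · have := mk_rel (HRel.yy (h := h) i j hij)
    simp only [map_mul] at this
    exact this.symm
  · rfl
  · have := mk_rel (HRel.yy (h := h) j i hij)
    simp only [map_mul] at this
    exact this

theorem xy (i j : I) : (x i * y j : HAlg h I) = y j * x i + h • (y j * y i) := by
  rcases lt_trichotomy i j with hij | rfl | hij
  · have := mk_rel (HRel.yx (h := h) i j hij)
    simp only [map_mul, map_sub, map_smul] at this
    change y j * x i = x i * y j - h • (y i * y j) at this
    rw [this, yy j i]; abel
  · have := mk_rel (HRel.xy_self (h := h) i)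
    simp only [map_mul, map_add, map_smul] at this
    exact this
  · have := mk_rel (HRel.xy (h := h) j i hij)
    simp only [map_mul, map_add, map_smul] at this
    exact this

theorem xx (i j : I) (hij : i < j) : (x j * x i : HAlg h I) =
    x i * x j - h • (x i * y j) + h • (y i * x j) + h ^ 2 • (y i * y j) := by
  have := mk_rel (HRel.xx (h := h) i j hij)
  simp only [map_mul, map_add, map_sub, map_smul] at this
  exact this

/-- An algebra homomorphism out of `H_I` from values on the generators. -/
noncomputable def lift {B : Type*} [Ring B] [Algebra ℂ B] (u v : I → B)
    (h1 : ∀ i j, v i * v j = v j * v i)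
    (h2 : ∀ i j, u i * v j = v j * u i + h • (v j * v i))
    (h3 : ∀ i j, i < j → u j * u i =
      u i * u j - h • (u i * v j) + h • (v i * u j) + h ^ 2 • (v i * v j)) :
    HAlg h I →ₐ[ℂ] B :=
  RingQuot.liftAlgHom ℂ ⟨FreeAlgebra.lift ℂ (fun g => Gen.casesOn g u v), by
    intro a b r
    cases r with
    | xy_self i => simpa [Gen.fx, Gen.fy] using h2 i i
    | xy i j hij => simpa [Gen.fx, Gen.fy] using h2 j i
    | yx i j hij => simp [Gen.fx, Gen.fy, h2 i j, h1 i j]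
    | yy i j hij => simpa [Gen.fx, Gen.fy] using h1 j i
    | xx i j hij => simpa [Gen.fx, Gen.fy] using h3 i j hij⟩

section
variable {B : Type*} [Ring B] [Algebra ℂ B] (u v : I → B)
    (h1 : ∀ i j, v i * v j = v j * v i)
    (h2 : ∀ i j, u i * v j = v j * u i + h • (v j * v i))
    (h3 : ∀ i j, i < j → u j * u i =
      u i * u j - h • (u i * v j) + h • (v i * u j) + h ^ 2 • (v i * v j))

@[simp] theorem lift_x (i : I) : lift u v h1 h2 h3 (x i) = u i := by
  simp only [lift, x, mk]
  erw [RingQuot.liftAlgHom_mkAlgHom_apply]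
  simp [Gen.fx]

@[simp] theorem lift_y (i : I) : lift u v h1 h2 h3 (y i) = v i := by
  simp only [lift, y, mk]
  erw [RingQuot.liftAlgHom_mkAlgHom_apply]
  simp [Gen.fy]

end

/-- `H_I` is generated by the `x_i, y_i`: induction principle. -/
theorem induction {P : HAlg h I → Prop} (hc : ∀ c : ℂ, P (algebraMap ℂ _ c))
    (hx : ∀ i, P (x i)) (hy : ∀ i, P (y i)) (ha : ∀ a b, P a → P b → P (a + b))
    (hm : ∀ a b, P a → P b → P (a * b)) (a : HAlg h I) : P a := by
  obtain ⟨a, rfl⟩ := RingQuot.mkAlgHom_surjective ℂ (HRel h I) a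
  change P (mk h I a)
  induction a using FreeAlgebra.induction with
  | grade0 r => rw [AlgHom.commutes]; exact hc r
  | grade1 g => cases g with
    | x i => exact hx i
    | y i => exact hy i
  | mul a b pa pb => rw [map_mul]; exact hm _ _ pa pb
  | add a b pa pb => rw [map_add]; exact ha _ _ pa pb


/-- The algebra automorphism `e^{tF}` of `H_I`: as `F` is a derivation with `F x_i = y_i`,
`F y_i = 0`, one has `e^{tF} x_i = x_i + t y_i`, `e^{tF} y_i = y_i`. -/
noncomputable def expF (t : ℂ) : HAlg h I →ₐ[ℂ] HAlg h I :=
  lift (fun i => x i + t • y i) y yy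
    (fun i j => by
      simp only [add_mul, mul_add, smul_mul_assoc, mul_smul_comm, xy, yy i j]; module)
    (fun i j hij => by
      simp only [add_mul, mul_add, smul_mul_assoc, mul_smul_comm, xx i j hij, xy i j, xy j i,
        yy j i]
      module)

/-- The homomorphism `a ↦ [[a, F a], [0, a]]`. -/
noncomputable def matF : HAlg h I →ₐ[ℂ] Matrix (Fin 2) (Fin 2) (HAlg h I) :=
  lift (fun i => !![x i, y i; 0, x i]) (fun i => !![y i, 0; 0, y i])
    (fun i j => by simp [yy i j])
    (fun i j => by
      ext a b; fin_cases a <;> fin_cases b <;> simp [xy i j, yy i j])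
    (fun i j hij => by
      ext a b; fin_cases a <;> fin_cases b <;> simp [xx i j hij, xy i j, xy j i, yy j i]
      all_goals module)

/-- The homomorphism `a ↦ [[e^{hF} a, E a], [0, e^{-hF} a]]`. -/
noncomputable def matE : HAlg h I →ₐ[ℂ] Matrix (Fin 2) (Fin 2) (HAlg h I) :=
  lift (fun i => !![x i + h • y i, 0; 0, x i - h • y i]) (fun i => !![y i, x i; 0, y i])
    (fun i j => by
      rcases lt_trichotomy i j with hij | rfl | hij
      · ext a b; fin_cases a <;> fin_cases b <;>
          simp [xy i j, xy j i, yy j i]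
        all_goals module
      · rfl
      · ext a b; fin_cases a <;> fin_cases b <;>
          simp [xy i j, xy j i, yy j i]
        all_goals module)
    (fun i j => by
      rcases lt_trichotomy i j with hij | rfl | hij
      · ext a b; fin_cases a <;> fin_cases b <;>
          simp [add_mul, mul_add, sub_mul, mul_sub, xx i j hij, xy i j, xy j i, yy j i]
        all_goals module
      · ext a b; fin_cases a <;> fin_cases b <;>
          simp [add_mul, mul_add, sub_mul, mul_sub, xy i i]
      · ext a b; fin_cases a <;> fin_cases b <;>
          simp [add_mul, mul_add, sub_mul, mul_sub, xx j i hij, xy i j, xy j i, yy j i]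
        all_goals module)
    (fun i j hij => by
      ext a b; fin_cases a <;> fin_cases b <;>
        simp [add_mul, mul_add, sub_mul, mul_sub, xx i j hij, xy i j, xy j i, yy j i]
      all_goals module)

/-- The homomorphism `a ↦ [[e^{hF} a, H a], [0, e^{-hF} a]]`. -/
noncomputable def matH : HAlg h I →ₐ[ℂ] Matrix (Fin 2) (Fin 2) (HAlg h I) :=
  lift (fun i => !![x i + h • y i, x i; 0, x i - h • y i]) (fun i => !![y i, -y i; 0, y i])
    (fun i j => by
      ext a b; fin_cases a <;> fin_cases b <;> simp [yy j i])
    (fun i j => by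
      ext a b; fin_cases a <;> fin_cases b <;>
        simp [add_mul, mul_add, sub_mul, mul_sub, xy i j, yy j i]
      all_goals module)
    (fun i j hij => by
      ext a b; fin_cases a <;> fin_cases b <;>
        simp [add_mul, mul_add, sub_mul, mul_sub, xx i j hij, xy i j, xy j i, yy j i]
      all_goals module)

/-- The action of `E` on `H_I`. -/
noncomputable def E : HAlg h I →ₗ[ℂ] HAlg h I :=
  (Matrix.entryLinearMap ℂ (HAlg h I) 0 1).comp matE.toLinearMap

/-- The action of `F` on `H_I`. -/
noncomputable def F : HAlg h I →ₗ[ℂ] HAlg h I :=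
  (Matrix.entryLinearMap ℂ (HAlg h I) 0 1).comp matF.toLinearMap

/-- The action of `H` on `H_I`. -/
noncomputable def H : HAlg h I →ₗ[ℂ] HAlg h I :=
  (Matrix.entryLinearMap ℂ (HAlg h I) 0 1).comp matH.toLinearMap

/-! The defining properties of the action: values on generators and twisted Leibniz rules. -/

@[simp] theorem expF_x (t : ℂ) (i : I) : expF t (x i : HAlg h I) = x i + t • y i := by
  simp [expF]
@[simp] theorem expF_y (t : ℂ) (i : I) : expF t (y i : HAlg h I) = y i := by simp [expF]
@[simp] theorem E_x (i : I) : E (x i : HAlg h I) = 0 := by simp [E, matE]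
@[simp] theorem E_y (i : I) : E (y i : HAlg h I) = x i := by simp [E, matE]
@[simp] theorem F_x (i : I) : F (x i : HAlg h I) = y i := by simp [F, matF]
@[simp] theorem F_y (i : I) : F (y i : HAlg h I) = 0 := by simp [F, matF]
@[simp] theorem H_x (i : I) : H (x i : HAlg h I) = x i := by simp [H, matH]
@[simp] theorem H_y (i : I) : H (y i : HAlg h I) = -y i := by simp [H, matH]
theorem E_one : E (1 : HAlg h I) = 0 := by simp [E]
theorem F_one : F (1 : HAlg h I) = 0 := by simp [F]
theorem H_one : H (1 : HAlg h I) = 0 := by simp [H]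

theorem matF_diag (a : HAlg h I) : matF a 0 0 = a ∧ matF a 1 1 = a ∧ matF a 1 0 = 0 := by
  induction a using HAlg.induction with
  | hc c => simp [Matrix.algebraMap_matrix_apply]
  | hx i => simp [matF]
  | hy i => simp [matF]
  | ha a b pa pb => simp [pa, pb]
  | hm a b pa pb => simp [Matrix.mul_apply, pa, pb]

theorem matE_diag (a : HAlg h I) :
    matE a 0 0 = expF h a ∧ matE a 1 1 = expF (-h) a ∧ matE a 1 0 = 0 := by
  induction a using HAlg.induction with
  | hc c => simp [Matrix.algebraMap_matrix_apply]
  | hx i => simp [matE, sub_eq_add_neg]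
  | hy i => simp [matE]
  | ha a b pa pb => simp [pa, pb]
  | hm a b pa pb => simp [Matrix.mul_apply, pa, pb]

theorem matH_diag (a : HAlg h I) :
    matH a 0 0 = expF h a ∧ matH a 1 1 = expF (-h) a ∧ matH a 1 0 = 0 := by
  induction a using HAlg.induction with
  | hc c => simp [Matrix.algebraMap_matrix_apply]
  | hx i => simp [matH, sub_eq_add_neg]
  | hy i => simp [matH]
  | ha a b pa pb => simp [pa, pb]
  | hm a b pa pb => simp [Matrix.mul_apply, pa, pb]

theorem F_mul (a b : HAlg h I) : F (a * b) = F a * b + a * F b := by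
  simp [F, Matrix.mul_apply, matF_diag, add_comm]

theorem E_mul (a b : HAlg h I) : E (a * b) = E a * expF (-h) b + expF h a * E b := by
  simp [E, Matrix.mul_apply, matE_diag, add_comm]

theorem H_mul (a b : HAlg h I) : H (a * b) = H a * expF (-h) b + expF h a * H b := by
  simp [H, Matrix.mul_apply, matH_diag, add_comm]

/-- The subalgebra `H_{I∖{o}}` of `H_I`, generated by the `x_i, y_i` with `i ≠ o`. -/
noncomputable def sub (h : ℂ) (o : I) : Subalgebra ℂ (HAlg h I) :=
  Algebra.adjoin ℂ {a | ∃ i, i ≠ o ∧ (a = x i ∨ a = y i)}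

end HAlg

/-! ### Skew field extensions of `H_I` -/

/-- A skew field `D` containing `H_I`, with an extension of the action of `U_h(sl(2))` from `H_I`
to `D`: the generators `E, F, H` act by linear maps, the group-like element `e^{hF}` acts by an
automorphism, and the (twisted) Leibniz rules hold on `D`. -/
structure SkewExt (h : ℂ) (I : Type*) [LinearOrder I] (D : Type*) [DivisionRing D]
    [Algebra ℂ D] where
  /-- the embedding of `H_I` -/
  ι : HAlg h I →ₐ[ℂ] D
  ι_injective : Function.Injective ι
  /-- the action of `e^{hF}`; its inverse is the action of `e^{-hF}` -/
  expF : D ≃ₐ[ℂ] D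
  /-- the action of `E` -/
  E : D →ₗ[ℂ] D
  /-- the action of `F` -/
  F : D →ₗ[ℂ] D
  /-- the action of `H` -/
  H : D →ₗ[ℂ] D
  expF_ι : ∀ a, expF (ι a) = ι (HAlg.expF h a)
  E_ι : ∀ a, E (ι a) = ι (HAlg.E a)
  F_ι : ∀ a, F (ι a) = ι (HAlg.F a)
  H_ι : ∀ a, H (ι a) = ι (HAlg.H a)
  E_mul : ∀ a b, E (a * b) = E a * expF.symm b + expF a * E b
  F_mul : ∀ a b, F (a * b) = F a * b + a * F b
  H_mul : ∀ a b, H (a * b) = H a * expF.symm b + expF a * H b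

namespace SkewExt

variable {h : ℂ} {I : Type*} [LinearOrder I] {D : Type*} [DivisionRing D] [Algebra ℂ D]

/-- An element is invariant if `U_h(sl(2))` acts on it through the counit:
`E v = F v = H v = 0` and `e^{hF} v = v`. (Where `e^{hF}` is given by the exponential series,
as on `H_I`, the last equation follows from `F v = 0`.) -/
def Inv (S : SkewExt h I D) (v : D) : Prop :=
  S.E v = 0 ∧ S.F v = 0 ∧ S.H v = 0 ∧ S.expF v = v

/-- The quotient skew field `Q_{I∖{o}}` of `H_{I∖{o}}`, realized in `D` as the skew subfield
generated by `H_{I∖{o}}`. -/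
def Q₀ (S : SkewExt h I D) (o : I) : Subfield D :=
  Subfield.closure (S.ι '' (HAlg.sub h o : Set (HAlg h I)))

end SkewExt

/-- A central skew field extension `D = Q_I^Σ = Q_I[σ, …]` of the quotient skew field `Q_I` of
`H_I`: it is generated as a skew field by `H_I` and a set of central invariant elements `σ`, each of
which is algebraic over the field `Q_{I∖{o}}^{Inv}` of invariants of `Q_{I∖{o}}`. -/
structure CentralExt (h : ℂ) {I : Type*} [LinearOrder I] (o : I) (D : Type*) [DivisionRing D]
    [Algebra ℂ D] extends SkewExt h I D where
  /-- the adjoined elements `σ` -/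
  roots : Set D
  roots_central : ∀ s ∈ roots, ∀ d : D, s * d = d * s
  roots_inv : ∀ s ∈ roots, toSkewExt.Inv s
  roots_algebraic : ∀ s ∈ roots, ∃ p : Polynomial D, p ≠ 0 ∧
    (∀ n, p.coeff n ∈ toSkewExt.Q₀ o ∧ toSkewExt.Inv (p.coeff n)) ∧ p.eval s = 0
  generates : Subfield.closure (Set.range ι ∪ roots) = ⊤

namespace CentralExt

variable {h : ℂ} {I : Type*} [LinearOrder I] {o : I} {D : Type*} [DivisionRing D] [Algebra ℂ D]
variable (S : CentralExt h o D)

/-- The variable `x = x_o`. -/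
noncomputable def x : D := S.ι (HAlg.x o)

/-- The variable `y = y_o`. -/
noncomputable def y : D := S.ι (HAlg.y o)

/-- The skew field of coefficients `Q_{I∖{o}}^Σ`, generated by `H_{I∖{o}}` and the `σ`. -/
def coeffs : Subfield D :=
  Subfield.closure (S.ι '' (HAlg.sub h o : Set (HAlg h I)) ∪ S.roots)

/-- `n`-forms in `x, y` with coefficients in `Q_{I∖{o}}^Σ`: nonvanishing invariant elements
`∑ i, (n choose i) x^{n-i} y^i A_i`. -/
def IsForm (n : ℕ) (f : D) : Prop :=
  f ≠ 0 ∧ S.Inv f ∧ ∃ A : ℕ → D, (∀ i, A i ∈ S.coeffs) ∧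
    f = ∑ i ∈ Finset.range (n + 1), n.choose i • (S.x ^ (n - i) * S.y ^ i * A i)

variable (h) in
/-- The bracket `(X X') = X Y' - Y X' - h Y Y'` of two points `(X, Y)`, `(X', Y')`. -/
noncomputable def bracket (X Y X' Y' : D) : D := X * Y' - Y * X' - h • (Y * Y')

/-- `X, Y` are the homogeneous coordinates of a linear form: `X, Y ∈ Q_{I∖{o}}^Σ` and
`(0X) = x Y - y X - h y Y` is a `1`-form. -/
def IsPoint (X Y : D) : Prop :=
  X ∈ S.coeffs ∧ Y ∈ S.coeffs ∧ S.IsForm 1 (bracket h S.x S.y X Y)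

variable (h) in
/-- The zero `Z = X Y⁻¹ + h/2` of the linear form with coordinates `X, Y`. -/
noncomputable def zero (X Y : D) : D := X * Y⁻¹ + algebraMap ℂ D (h / 2)

/-- `Δ` is the derivation with `x ↦ X`, `y ↦ Y` which vanishes on the coefficients. -/
structure IsPolarDer (X Y : D) (Δ : D →ₗ[ℂ] D) : Prop where
  leibniz : ∀ a b, Δ (a * b) = Δ a * b + a * Δ b
  map_x : Δ S.x = X
  map_y : Δ S.y = Y
  map_coeffs : ∀ a ∈ S.coeffs, Δ a = 0

theorem coord_cases (i : I) : (S.ι (HAlg.x i) ∈ S.coeffs ∧ S.ι (HAlg.y i) ∈ S.coeffs) ∨ i = o := by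
  by_cases hi : i = o
  · exact Or.inr hi
  · exact Or.inl
      ⟨Subfield.subset_closure (Or.inl ⟨_, Algebra.subset_adjoin ⟨i, hi, Or.inl rfl⟩, rfl⟩),
       Subfield.subset_closure (Or.inl ⟨_, Algebra.subset_adjoin ⟨i, hi, Or.inr rfl⟩, rfl⟩)⟩

/-- The defining properties determine the derivation. -/
theorem IsPolarDer.unique {X Y : D} {Δ Δ' : D →ₗ[ℂ] D} (h1 : S.IsPolarDer X Y Δ)
    (h2 : S.IsPolarDer X Y Δ') : Δ = Δ' := by
  have one : ∀ {Δ : D →ₗ[ℂ] D}, S.IsPolarDer X Y Δ → Δ 1 = 0 :=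
    fun hd => hd.map_coeffs 1 (one_mem _)
  have key : ∀ d ∈ Subfield.closure (Set.range S.ι ∪ S.roots), Δ d = Δ' d := by
    intro d hd
    induction hd using Subfield.closure_induction with
    | mem d hd =>
      rcases hd with ⟨a, rfl⟩ | hd
      · induction a using HAlg.induction with
        | hc c =>
          have e : S.ι (algebraMap ℂ _ c) = c • (1 : D) := by
            rw [AlgHom.commutes, Algebra.algebraMap_eq_smul_one]
          rw [e, map_smul, map_smul, one h1, one h2]
        | hx i =>
          rcases S.coord_cases i with hi | rfl
          · rw [h1.map_coeffs _ hi.1, h2.map_coeffs _ hi.1]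
          · exact h1.map_x.trans h2.map_x.symm
        | hy i =>
          rcases S.coord_cases i with hi | rfl
          · rw [h1.map_coeffs _ hi.2, h2.map_coeffs _ hi.2]
          · exact h1.map_y.trans h2.map_y.symm
        | ha a b pa pb => rw [map_add, map_add, map_add, pa, pb]
        | hm a b pa pb => rw [map_mul, h1.leibniz, h2.leibniz, pa, pb]
      · have hc : d ∈ S.coeffs := Subfield.subset_closure (Or.inr hd)
        rw [h1.map_coeffs _ hc, h2.map_coeffs _ hc]
    | one => rw [one h1, one h2]
    | add a b _ _ pa pb => rw [map_add, map_add, pa, pb]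
    | neg a _ pa => rw [map_neg, map_neg, pa]
    | mul a b _ _ pa pb => rw [h1.leibniz, h2.leibniz, pa, pb]
    | inv a _ pa =>
      by_cases h0 : a = 0
      · simp [h0]
      · have e1 := h1.leibniz a a⁻¹
        have e2 := h2.leibniz a a⁻¹
        rw [mul_inv_cancel₀ h0, one h1] at e1
        rw [mul_inv_cancel₀ h0, one h2, ← pa, e1] at e2
        exact mul_left_cancel₀ h0 (add_left_cancel e2)
  ext d
  exact key d (by rw [S.generates]; trivial)

open Classical in
/-- The polarization derivation `Δ_{(x,y),(X,Y)}` of `D`: the derivation with `x ↦ X`, `y ↦ Y` which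
vanishes on the coefficients. It is unique (`IsPolarDer.unique`), and it exists if `X, Y` are the homogeneous coordinates
of a linear form; otherwise the value is immaterial. -/
noncomputable def polarDer (X Y : D) : D →ₗ[ℂ] D :=
  if hd : ∃ Δ, S.IsPolarDer X Y Δ then hd.choose else 0

/-- The power `P_{(x,y),(X,Y)}^m` of the polarization operator on elements which are homogeneous of
degree `n` in `x, y`. On these `P = (1/n) Δ`, and `P` lowers the degree by one. -/
noncomputable def polar (X Y : D) : (m n : ℕ) → D → D
  | 0, _, a => a
  | m + 1, n, a => polar X Y m (n - 1) ((n : ℂ)⁻¹ • S.polarDer X Y a)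

end CentralExt

/-! The centre `K` of `D` is a field, and over it the statement becomes a commutative identity. Fix
an index `j ≠ o`. Every point is a combination `X = y_j⁻¹ a + x_j b`, `Y = y_j b` with `a, b ∈ K`.
The bracket of two points is then the ordinary determinant `a b' - b a'`, which is nonzero when the
zeros differ, since proportional coordinates have equal zeros. Polarizing `g` completely means
substituting `(X_i, Y_i)` for `(x, y)`; as `a_i, b_i` are central, the result is `∑ a_i ^ p b_i ^
(k-2-p) B_p` with `B_p ∈ D` independent of `i`. The coefficient of each `B_p` vanishes by
`sum_monomial_div_prod_det_eq_zero`.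

Two facts need proof: the parameters `a, b` are central, and the derivation `x ↦ X`, `y ↦ Y` exists.
Both rest on `exists_isPolarDer`. Moving `x_k` or `y_k` past an element of `D` is expressed by `H`
and `e^{±hF}` (`gx_mul`, `gy_mul`), so invariants, in particular `(0X)`, are central. Derivations
preserve the centre; the ones sending `(x, y)` to `(x_j, y_j)` and to `(y_j⁻¹, 0)` take `(0X)` to
`-a` and `b`. Conversely, central `a, b` give a derivation with values `X, Y`.

To construct the derivation, note that `D` is generated over `K` by `w = y_j⁻¹ x_j` and `y_j`, with
`w y_j = y_j w + h y_j`. The monomials `w ^ m y_j ^ n` are independent over `K` and span an Ore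
domain, so `D` is its skew field of fractions. A derivation on `H_I`, read off from the relations,
prescribes values on the central elements `y_j⁻¹ y_i` and `y_j x_i - y_i x_j`. It extends to `K`
because field extensions in characteristic zero are formally smooth, and from `K` to `D` by zero on
`w` and `y_j`. It kills the adjoined roots because they are algebraic over elements that it kills.
-/

/-! ### Homogeneous interpolation -/

/-- For points `(a i, b i)` with pairwise nonzero determinants, the sum of the values of a binary form
of degree `|s| - 2`, divided by the products of determinants, vanishes. -/
theorem sum_monomial_div_prod_det_eq_zero {K ι : Type*} [Field K] [DecidableEq ι] (a b : ι → K) :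
    ∀ (p q : ℕ) (s : Finset ι), s.card = p + q + 2 →
      (∀ i ∈ s, ∀ j ∈ s, i ≠ j → a i * b j - b i * a j ≠ 0) →
      ∑ i ∈ s, a i ^ p * b i ^ q / ∏ j ∈ s.erase i, (a i * b j - b i * a j) = 0 := by
  -- lowering the degree by means of the three-term Plücker relation
  have step : ∀ (v f : ι → K) (s : Finset ι) (l m : ι), l ∈ s → m ∈ s → l ≠ m →
      (∀ i ∈ s, ∀ j ∈ s, i ≠ j → a i * b j - b i * a j ≠ 0) →
      (∀ i, (a l * b m - b l * a m) * v i =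
        v l * (a i * b m - b i * a m) - v m * (a i * b l - b i * a l)) →
      (∑ i ∈ s.erase m, f i / ∏ j ∈ (s.erase m).erase i, (a i * b j - b i * a j) = 0) →
      (∑ i ∈ s.erase l, f i / ∏ j ∈ (s.erase l).erase i, (a i * b j - b i * a j) = 0) →
      ∑ i ∈ s, v i * f i / ∏ j ∈ s.erase i, (a i * b j - b i * a j) = 0 := by
    intro v f s l m hl hm hlm hs hv h1 h2
    -- The numerator `(i m)` kills the term `i = m` and cancels the factor `(i m)` in every other
    -- denominator, so the point `m` disappears from the sum.
    have cancel : ∀ m ∈ s, ∑ i ∈ s, (a i * b m - b i * a m) * f i /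
        ∏ j ∈ s.erase i, (a i * b j - b i * a j) =
        ∑ i ∈ s.erase m, f i / ∏ j ∈ (s.erase m).erase i, (a i * b j - b i * a j) := by
      intro m hm
      rw [← Finset.add_sum_erase s _ hm]
      have : a m * b m - b m * a m = 0 := by ring
      rw [this, zero_mul, zero_div, zero_add]
      refine Finset.sum_congr rfl fun i hi => ?_
      obtain ⟨him, his⟩ := Finset.mem_erase.1 hi
      rw [Finset.erase_right_comm, ← Finset.mul_prod_erase (s.erase i) _
        (Finset.mem_erase.2 ⟨him.symm, hm⟩)]
      exact mul_div_mul_left _ _ (hs i his m hm him)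
    refine (mul_eq_zero.1 ?_).resolve_left (hs l hl m hm hlm)
    rw [Finset.mul_sum]
    calc ∑ i ∈ s, (a l * b m - b l * a m) *
          (v i * f i / ∏ j ∈ s.erase i, (a i * b j - b i * a j))
        = ∑ i ∈ s, (v l * ((a i * b m - b i * a m) * f i /
            ∏ j ∈ s.erase i, (a i * b j - b i * a j)) - v m * ((a i * b l - b i * a l) * f i /
            ∏ j ∈ s.erase i, (a i * b j - b i * a j))) := by
          refine Finset.sum_congr rfl fun i _ => ?_
          rw [← mul_div_assoc, ← mul_assoc, hv]
          ring
      _ = 0 := by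
          rw [Finset.sum_sub_distrib, ← Finset.mul_sum, ← Finset.mul_sum, cancel m hm, cancel l hl,
            h1, h2]
          ring
  intro p q
  induction hn : p + q generalizing p q with
  | zero =>
    intro s hc hs
    obtain ⟨rfl, rfl⟩ : p = 0 ∧ q = 0 := by omega
    obtain ⟨l, m, hlm, rfl⟩ := Finset.card_eq_two.1 (by simpa using hc)
    have e1 : ({l, m} : Finset ι).erase l = {m} := by
      ext x; simp only [Finset.mem_erase, Finset.mem_insert, Finset.mem_singleton]
      constructor
      · rintro ⟨h1, h2 | h2⟩ <;> tauto
      · rintro rfl; exact ⟨hlm.symm, Or.inr rfl⟩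
    have e2 : ({l, m} : Finset ι).erase m = {l} := by
      ext x; simp only [Finset.mem_erase, Finset.mem_insert, Finset.mem_singleton]
      constructor
      · rintro ⟨h1, h2 | h2⟩ <;> tauto
      · rintro rfl; exact ⟨hlm, Or.inl rfl⟩
    have h1 := hs l (by simp) m (by simp) hlm
    have h2 := hs m (by simp) l (by simp) hlm.symm
    rw [Finset.sum_pair hlm, e1, e2]
    simp only [pow_zero, mul_one, Finset.prod_singleton]
    rw [div_add_div _ _ h1 h2]
    rw [div_eq_zero_iff]; left; ring
  | succ n ih =>
    intro s hc hs
    obtain ⟨l, hl, m, hm, hlm⟩ := Finset.one_lt_card.1 (show 1 < s.card by omega)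
    have sub : ∀ p q, p + q = n → ∀ m ∈ s,
        ∑ i ∈ s.erase m, a i ^ p * b i ^ q /
          ∏ j ∈ (s.erase m).erase i, (a i * b j - b i * a j) = 0 := by
      intro p q hpq m hm
      refine ih p q hpq (s.erase m) ?_ fun i hi j hj =>
        hs i (Finset.mem_of_mem_erase hi) j (Finset.mem_of_mem_erase hj)
      rw [Finset.card_erase_of_mem hm]; omega
    rcases p with _ | p
    · obtain ⟨q, rfl⟩ : ∃ r, q = r + 1 := ⟨q - 1, by omega⟩
      rw [← step b (fun i => a i ^ 0 * b i ^ q) s l m hl hm hlm hs (fun i => by ring)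
        (sub 0 q (by omega) m hm) (sub 0 q (by omega) l hl)]
      refine Finset.sum_congr rfl fun i _ => ?_
      congr 1; ring
    · rw [← step a (fun i => a i ^ p * b i ^ q) s l m hl hm hlm hs (fun i => by ring)
        (sub p q (by omega) m hm) (sub p q (by omega) l hl)]
      refine Finset.sum_congr rfl fun i _ => ?_
      congr 1; ring

/-! ### Extension of derivations of commutative fields -/

/-- A transcendence basis splits `L / F` into a purely transcendental extension and an algebraic
one, which is separable in characteristic zero. -/
theorem formallySmooth_of_charZero (F L : Type*) [Field F] [Field L] [Algebra F L] [CharZero F] :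
    Algebra.FormallySmooth F L := by
  obtain ⟨s, hs⟩ := exists_isTranscendenceBasis F L
  have := hs.isAlgebraic_field
  exact .of_algebraicIndependent_of_isSeparable hs.1

/-- Lifting along a square zero extension of a field of characteristic zero. -/
theorem exists_ringHom_lift_of_sq_zero {F L B : Type*} [Field F] [CharZero F] [Field L] [CommRing B]
    (f : F →+* B) (π : B →+* L) (hπ : Function.Surjective π) (hker : ∀ a b, π a = 0 → π b = 0 → a * b = 0) :
    ∃ g : L →+* B, (∀ z, π (g z) = z) ∧ ∀ r, g (π (f r)) = f r := by
  -- With `F` as base ring through `f`, being an `F`-algebra map is exactly the requirement that the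
  -- lift agree with `f`.
  let _ := f.toAlgebra
  let _ := (π.comp f).toAlgebra
  have := formallySmooth_of_charZero F L
  let π' : B →ₐ[F] L := { π with commutes' := fun r => rfl }
  have hnil : IsNilpotent (RingHom.ker π') := by
    refine ⟨2, ?_⟩
    rw [pow_two, Ideal.zero_eq_bot, eq_bot_iff, Ideal.mul_le]
    exact fun a ha b hb => hker a b ha hb
  let g := Algebra.FormallySmooth.liftOfSurjective (AlgHom.id F L) π' hπ hnil
  refine ⟨g, fun z => ?_, fun r => g.commutes r⟩
  exact Algebra.FormallySmooth.liftOfSurjective_apply (AlgHom.id F L) π' hπ hnil z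

/-- A derivation into a field of characteristic zero extends from any subring; here it is given by
its graph, a subring of the dual numbers. -/
theorem exists_derivation_of_graph {L : Type*} [Field L] [CharZero L] (R : Subring (DualNumber L))
    (hR : ∀ r ∈ R, TrivSqZeroExt.fst r = 0 → r = 0) :
    ∃ d : L →+ L, (∀ a b, d (a * b) = d a * b + a * d b) ∧
      ∀ r ∈ R, d (TrivSqZeroExt.fst r) = TrivSqZeroExt.snd r := by
  let π : DualNumber L →+* L := (TrivSqZeroExt.fstHom L L L).toRingHom
  have hinj : Function.Injective (π.comp R.subtype) := by
    rw [injective_iff_map_eq_zero]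
    rintro ⟨r, hr⟩ h0
    exact Subtype.ext (hR r hr h0)
  have : IsDomain R := hinj.isDomain _
  -- A nonzero element of the graph has nonzero first component and is therefore a unit, so the
  -- fraction field of `R` maps to the dual numbers.
  have hu : ∀ r : nonZeroDivisors R, IsUnit (R.subtype r) := by
    rintro ⟨r, hr⟩
    rw [TrivSqZeroExt.isUnit_iff_isUnit_fst, isUnit_iff_ne_zero]
    intro h0
    exact nonZeroDivisors.ne_zero hr (Subtype.ext (hR r r.2 h0))
  let f : FractionRing R →+* DualNumber L := IsLocalization.lift hu
  have hf : ∀ r : R, f (algebraMap R _ r) = r := fun r => IsLocalization.lift_eq hu r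
  have : CharZero (FractionRing R) := (π.comp f).charZero
  have hker : ∀ a b, π a = 0 → π b = 0 → a * b = 0 := by
    intro a b ha hb
    have ha' : a.fst = 0 := ha
    have hb' : b.fst = 0 := hb
    ext <;> simp [ha', hb']
  -- A ring section of `fst` has the form `z ↦ z + d z ε` with `d` a derivation; since it fixes `R`,
  -- this `d` extends the graph.
  obtain ⟨g, hg1, hg2⟩ := exists_ringHom_lift_of_sq_zero f π
    (fun z => ⟨TrivSqZeroExt.inl z, rfl⟩) hker
  have hg1' : ∀ z, (g z).fst = z := hg1
  refine ⟨(TrivSqZeroExt.sndHom L L).toAddMonoidHom.comp g.toAddMonoidHom, fun a b => ?_,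
    fun r hr => ?_⟩
  · change (g (a * b)).snd = (g a).snd * b + a * (g b).snd
    rw [map_mul, TrivSqZeroExt.snd_mul, hg1', hg1']
    simp [mul_comm, add_comm]
  · change (g r.fst).snd = r.snd
    have := hg2 (algebraMap R _ ⟨r, hr⟩)
    rw [hf] at this
    exact congrArg TrivSqZeroExt.snd this

/-! ### Skew fields of fractions -/

section Ore

variable {D : Type*} [DivisionRing D]

/-- If the subring `A` generates the skew field `D` and satisfies the left Ore condition, then every
element of `D` is a left fraction. -/
theorem exists_left_denominator (A : Subring D)
    (ore : ∀ p ∈ A, ∀ q ∈ A, q ≠ 0 → ∃ p' ∈ A, ∃ q' ∈ A, q' ≠ 0 ∧ q' * p = p' * q)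
    (d : D) (hd : d ∈ Subfield.closure (A : Set D)) : ∃ q ∈ A, q ≠ 0 ∧ q * d ∈ A := by
  induction hd using Subfield.closure_induction with
  | mem d hd => exact ⟨1, one_mem _, one_ne_zero, by simpa using hd⟩
  | one => exact ⟨1, one_mem _, one_ne_zero, by simp⟩
  | add d e _ _ pd pe =>
    obtain ⟨q, hq, hq0, hqd⟩ := pd
    obtain ⟨r, hr, hr0, hre⟩ := pe
    obtain ⟨p', hp', q', hq', hq'0, e1⟩ := ore q hq r hr hr0
    refine ⟨q' * q, mul_mem hq' hq, mul_ne_zero hq'0 hq0, ?_⟩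
    rw [mul_add, mul_assoc, e1, mul_assoc]
    exact add_mem (mul_mem hq' hqd) (mul_mem hp' hre)
  | neg d _ pd =>
    obtain ⟨q, hq, hq0, hqd⟩ := pd
    exact ⟨q, hq, hq0, by rw [mul_neg]; exact neg_mem hqd⟩
  | mul d e _ _ pd pe =>
    obtain ⟨q, hq, hq0, hqd⟩ := pd
    obtain ⟨r, hr, hr0, hre⟩ := pe
    obtain ⟨p', hp', q', hq', hq'0, e1⟩ := ore (q * d) hqd r hr hr0
    refine ⟨q' * q, mul_mem hq' hq, mul_ne_zero hq'0 hq0, ?_⟩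
    rw [show q' * q * (d * e) = q' * (q * d) * e by simp only [mul_assoc], e1, mul_assoc]
    exact mul_mem hp' hre
  | inv d _ pd =>
    obtain ⟨q, hq, hq0, hqd⟩ := pd
    by_cases h0 : d = 0
    · exact ⟨1, one_mem _, one_ne_zero, by simp [h0]⟩
    · exact ⟨q * d, hqd, mul_ne_zero hq0 h0, by rwa [mul_assoc, mul_inv_cancel₀ h0, mul_one]⟩

/-- A derivation extends from a subring to its skew field of left fractions. -/
theorem exists_derivation_of_left_denominators (A : Subring D)
    (den : ∀ d : D, ∃ q ∈ A, q ≠ 0 ∧ q * d ∈ A) (δ : D →+ D)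
    (hδ : ∀ a ∈ A, ∀ b ∈ A, δ (a * b) = δ a * b + a * δ b) :
    ∃ Δ : D →+ D, (∀ a b, Δ (a * b) = Δ a * b + a * Δ b) ∧ ∀ a ∈ A, Δ a = δ a := by
  have ore : ∀ p ∈ A, ∀ q ∈ A, q ≠ 0 → ∃ p' ∈ A, ∃ q' ∈ A, q' ≠ 0 ∧ q' * p = p' * q := by
    intro p _ q _ hq0
    obtain ⟨r, hr, hr0, h1⟩ := den (p * q⁻¹)
    exact ⟨_, h1, r, hr, hr0, by rw [mul_assoc, mul_assoc, inv_mul_cancel₀ hq0, mul_one]⟩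
  -- The Leibniz rule for `q * d` forces the value at `d`. Two denominators give the same value, as
  -- one sees after passing to a common multiple `a * q = b * q'`.
  have unique : ∀ d e e' q q', q ∈ A → q * d ∈ A → q ≠ 0 → q' ∈ A → q' * d ∈ A → q' ≠ 0 →
      δ (q * d) = δ q * d + q * e → δ (q' * d) = δ q' * d + q' * e' → e = e' := by
    intro d e e' q q' hq hqd hq0 hq' hqd' hq0' h1 h2
    obtain ⟨b, hb, a, ha, ha0, hab⟩ := ore q hq q' hq' hq0'
    have k1 := hδ a ha _ hqd
    have k2 := hδ b hb _ hqd'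
    have k3 := hδ a ha q hq
    have k4 := hδ b hb q' hq'
    rw [h1] at k1
    rw [h2] at k2
    rw [← mul_assoc, hab] at k1
    rw [← mul_assoc, k1] at k2
    rw [hab, k4] at k3
    have k5 := congrArg (· * d) k3
    simp only [add_mul, mul_add, ← mul_assoc] at k2 k5
    rw [hab] at k2
    have : b * q' * e = b * q' * e' := by
      have k6 : δ a * q * d + a * δ q * d + b * q' * e =
        δ b * q' * d + b * δ q' * d + b * q' * e' := by rw [add_assoc, add_assoc, ← k2]
      rw [k5] at k6
      exact add_left_cancel k6
    refine mul_left_cancel₀ ?_ this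
    rw [← hab]
    exact mul_ne_zero ha0 hq0
  choose den hden hden0 hdenm using den
  let val : D → D := fun d => (den d)⁻¹ * (δ (den d * d) - δ (den d) * d)
  have hval : ∀ d, δ (den d * d) = δ (den d) * d + den d * val d := by
    intro d
    simp only [val]
    rw [← mul_assoc, mul_inv_cancel₀ (hden0 d), one_mul]
    abel
  have charac : ∀ d e q, q ∈ A → q * d ∈ A → q ≠ 0 → δ (q * d) = δ q * d + q * e → val d = e :=
    fun d e q hq hqd hq0 h1 =>
      unique d _ e _ q (hden d) (hdenm d) (hden0 d) hq hqd hq0 (hval d) h1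
  clear_value val
  have hadd : ∀ d e, val (d + e) = val d + val e := by
    intro d e
    obtain ⟨b, hb, a, ha, ha0, hab⟩ := ore (den d) (hden d) (den e) (hden e) (hden0 e)
    have k : a * den d * (d + e) = a * (den d * d) + b * (den e * e) := by
      rw [mul_add, mul_assoc, hab, mul_assoc]
    refine charac _ _ (a * den d) (mul_mem ha (hden d)) ?_ (mul_ne_zero ha0 (hden0 d)) ?_
    · rw [k]
      exact add_mem (mul_mem ha (hdenm d)) (mul_mem hb (hdenm e))
    · rw [k, map_add, hδ a ha _ (hdenm d), hδ b hb _ (hdenm e), hval, hval]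
      have k1 := hδ a ha _ (hden d)
      have k2 := hδ b hb _ (hden e)
      rw [← hab] at k2
      rw [mul_add (δ (a * den d)), mul_add (a * den d)]
      nth_rewrite 1 [k1]
      rw [k2, hab]
      nth_rewrite 1 [← hab]
      simp only [mul_add, add_mul, ← mul_assoc]
      abel
  have hmul : ∀ d e, val (d * e) = val d * e + d * val e := by
    intro d e
    obtain ⟨b, hb, a, ha, ha0, hab⟩ := ore _ (hdenm d) (den e) (hden e) (hden0 e)
    have k : a * den d * (d * e) = b * (den e * e) := by
      rw [show a * den d * (d * e) = a * (den d * d) * e by simp only [mul_assoc], hab, mul_assoc]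
    refine charac _ _ (a * den d) (mul_mem ha (hden d)) ?_ (mul_ne_zero ha0 (hden0 d)) ?_
    · rw [k]; exact mul_mem hb (hdenm e)
    · rw [k, hδ b hb _ (hdenm e), hval]
      have k1 := hδ a ha _ (hden d)
      have k2 := hδ b hb _ (hden e)
      have k3 := hδ a ha _ (hdenm d)
      rw [hab, k2, hval] at k3
      have k4 := congrArg (· * e) k3
      have k5 : b * den e * val e = a * den d * d * val e := by rw [← hab, ← mul_assoc]
      rw [k1]
      simp only [mul_add, add_mul, ← mul_assoc] at k4 k5 ⊢
      rw [k5, ← add_assoc, k4]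
      abel
  refine ⟨⟨⟨val, by simpa using hadd 0 0⟩, hadd⟩, hmul, fun a ha => ?_⟩
  have h1 : δ 1 = 0 := by simpa using hδ 1 (one_mem _) 1 (one_mem _)
  exact charac a (δ a) 1 (one_mem _) (by simpa using ha) one_ne_zero (by simp [h1])

end Ore

/-! ### Skew fields generated over a central field by `w, y` with `w y = y w + c y` -/

section ShiftAlgebra

open Polynomial

variable {K D : Type*} [Field K] [DivisionRing D] [Algebra K D] {w y : D} {c : K}

/-- The relation says `y (w + c) = w y`, hence `y p(w + c) = p(w) y` for every polynomial `p`, and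
`y` can be cancelled. -/
theorem aeval_shift_eq_zero (hy : y ≠ 0) (hwy : w * y = y * w + c • y) (p : K[X])
    (hp : aeval w p = 0) : aeval w (p.comp (X + C c)) = 0 := by
  have h1 : ∀ p : K[X], y * aeval w (p.comp (X + C c)) = aeval w p * y := by
    intro p
    have h0 : y * (w + algebraMap K D c) = w * y := by
      rw [hwy, mul_add, ← Algebra.commutes, Algebra.smul_def]
    have hX : ∀ n : ℕ, y * (w + algebraMap K D c) ^ n = w ^ n * y :=
      fun n => SemiconjBy.pow_right (a := y) (x := w + algebraMap K D c) (y := w) h0 n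
    induction p using Polynomial.induction_on' with
    | add p q hp hq => rw [add_comp, map_add, map_add, mul_add, add_mul, hp, hq]
    | monomial n a =>
      rw [monomial_comp, ← C_mul_X_pow_eq_monomial]
      simp only [map_mul, map_pow, map_add, aeval_C, aeval_X]
      rw [← mul_assoc, ← Algebra.commutes, mul_assoc, hX, mul_assoc]
  have h2 := h1 p
  rw [hp, zero_mul] at h2
  exact (mul_eq_zero.1 h2).resolve_left hy

/-- The element `w` is transcendental over `K`. -/
theorem eq_zero_of_aeval_eq_zero [CharZero K] (hc : c ≠ 0) (hy : y ≠ 0) (hwy : w * y = y * w + c • y) (p : K[X])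
    (hp : aeval w p = 0) : p = 0 := by
  by_contra hp0
  have hint : IsIntegral K w := isAlgebraic_iff_isIntegral.1 ⟨p, hp0, hp⟩
  set m := minpoly K w with hm
  have hmon : m.Monic := minpoly.monic hint
  have hcomp : (m.comp (X + C c)).Monic := hmon.comp_X_add_C c
  have hdeg : (m.comp (X + C c)).degree = m.degree := by
    rw [degree_eq_natDegree hcomp.ne_zero, degree_eq_natDegree hmon.ne_zero, natDegree_comp]
    simp
  -- The shifted minimal polynomial is monic of the same degree and also kills `w`. Shift invariance
  -- makes `m` constant on the infinite set of multiples `n c`, which is absurd for positive degree.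
  have heq : m.comp (X + C c) = m :=
    minpoly.unique' K w hcomp (aeval_shift_eq_zero hy hwy m (minpoly.aeval K w)) fun q hq => by
      by_cases hq0 : q = 0
      · exact Or.inl hq0
      · refine Or.inr fun h0 => ?_
        have := minpoly.degree_le_of_ne_zero K w hq0 h0
        rw [hdeg] at hq
        exact absurd hq (not_lt.2 this)
  have heval : ∀ n : ℕ, m.eval (n * c) = m.eval 0 := by
    intro n
    induction n with
    | zero => simp
    | succ n ih =>
      rw [← ih]
      conv_rhs => rw [← heq]
      simp [add_mul]
  have hconst : m = C (m.eval 0) := by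
    refine eq_of_infinite_eval_eq _ _ (Set.infinite_of_injective_forall_mem
      (f := fun n : ℕ => (n : K) * c) (fun a b hab => ?_) fun n => ?_)
    · exact_mod_cast mul_right_cancel₀ hc hab
    · simpa using heval n
  have := minpoly.natDegree_pos hint
  rw [← hm, hconst] at this
  simp at this

theorem pow_mul_eq_sub_mul_pow (hwy : w * y = y * w + c • y) (b k : ℕ) :
    y ^ b * w ^ k = (w - b • (c • 1)) ^ k * y ^ b := by
  have h1 : y ^ b * w = (w - b • (c • 1)) * y ^ b := by
    have h0 : y * w = w * y - c • y := by rw [hwy]; abel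
    induction b with
    | zero => simp
    | succ b ih =>
      rw [pow_succ, mul_assoc, h0, mul_sub, ← mul_assoc, ih, mul_smul_comm]
      simp only [sub_mul, smul_mul_assoc, one_mul, mul_assoc, succ_nsmul, add_mul]
      abel
  exact SemiconjBy.pow_right (a := y ^ b) (x := w) (y := w - b • (c • 1)) h1 k

/-- Each `p_b(w) y ^ b` is an eigenvector of the commutator with `w`, with eigenvalue `b c`.
Subtracting `N c` times the relation from its commutator removes the top term and multiplies the
others by nonzero constants, so induction applies; the last term is settled by the transcendence of
`w`. -/
theorem coeff_eq_zero_of_sum_mul_pow_eq_zero [CharZero K] (hc : c ≠ 0) (hy : y ≠ 0)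
    (hwy : w * y = y * w + c • y) (N : ℕ) : ∀ p : ℕ → K[X],
      ∑ b ∈ Finset.range N, aeval w (p b) * y ^ b = 0 → ∀ b < N, p b = 0 := by
  induction N with
  | zero => intro p _ b hb; omega
  | succ N ih =>
    intro p hp
    have hcomm : ∀ b, w * (aeval w (p b) * y ^ b) - (aeval w (p b) * y ^ b) * w =
        ((b : K) * c) • (aeval w (p b) * y ^ b) := by
      intro b
      have h1 := pow_mul_eq_sub_mul_pow hwy b 1
      rw [pow_one, pow_one] at h1
      have h2 : w * aeval w (p b) = aeval w (p b) * w := by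
        have := congrArg (aeval w) (mul_comm X (p b))
        simpa using this
      rw [mul_assoc (aeval w (p b)), h1, ← mul_assoc, h2, sub_mul, mul_sub, ← mul_assoc,
        sub_sub_cancel, mul_smul]
      simp only [smul_mul_assoc, one_mul, mul_smul_comm, Nat.cast_smul_eq_nsmul]
    have hlow : ∑ b ∈ Finset.range N, aeval w (C (((b : K) - N) * c) * p b) * y ^ b = 0 := by
      have h1 : ∑ b ∈ Finset.range (N + 1), (w * (aeval w (p b) * y ^ b) -
          (aeval w (p b) * y ^ b) * w - ((N : K) * c) • (aeval w (p b) * y ^ b)) = 0 := by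
        rw [Finset.sum_sub_distrib, Finset.sum_sub_distrib, ← Finset.mul_sum, ← Finset.sum_mul,
          ← Finset.smul_sum, hp]
        simp
      rw [Finset.sum_range_succ, hcomm, sub_self, add_zero] at h1
      rw [← h1]
      refine Finset.sum_congr rfl fun b _ => ?_
      rw [hcomm, ← sub_smul, ← sub_mul, map_mul, aeval_C, ← Algebra.smul_def, smul_mul_assoc]
    have hz : ∀ b < N, p b = 0 := by
      intro b hb
      have h1 := ih _ hlow b hb
      refine (mul_eq_zero.1 h1).resolve_left ?_
      refine C_ne_zero.2 (mul_ne_zero (sub_ne_zero.2 ?_) hc)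
      exact_mod_cast hb.ne
    intro b hb
    rcases Nat.lt_succ_iff_lt_or_eq.1 hb with hb | rfl
    · exact hz b hb
    · rw [Finset.sum_range_succ, Finset.sum_eq_zero fun i hi => by
        rw [hz i (Finset.mem_range.1 hi), map_zero, zero_mul], zero_add] at hp
      exact eq_zero_of_aeval_eq_zero hc hy hwy _
        ((mul_eq_zero.1 hp).resolve_right (pow_ne_zero _ hy))

/-- The monomials `w ^ a * y ^ b` are linearly independent. -/
theorem linearIndependent_monomials [CharZero K] (hc : c ≠ 0) (hy : y ≠ 0) (hwy : w * y = y * w + c • y) :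
    LinearIndependent K (fun i : ℕ × ℕ => w ^ i.1 * y ^ i.2) := by
  classical
  rw [linearIndependent_iff']
  intro s g hg i hi
  obtain ⟨N, hN⟩ : ∃ N, ∀ j ∈ s, j.1 < N ∧ j.2 < N :=
    ⟨s.sup Prod.fst + s.sup Prod.snd + 1, fun j hj => by
      have h1 := Finset.le_sup (f := Prod.fst) hj
      have h2 := Finset.le_sup (f := Prod.snd) hj
      omega⟩
  let g' : ℕ × ℕ → K := fun j => if j ∈ s then g j else 0
  let p : ℕ → K[X] := fun b => ∑ a ∈ Finset.range N, monomial a (g' (a, b))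
  have hsub : s ⊆ Finset.range N ×ˢ Finset.range N := fun j hj => by
    simpa using hN j hj
  have hsum : ∑ b ∈ Finset.range N, aeval w (p b) * y ^ b = 0 := by
    rw [← hg]
    calc ∑ b ∈ Finset.range N, aeval w (p b) * y ^ b
        = ∑ j ∈ Finset.range N ×ˢ Finset.range N, g' j • (w ^ j.1 * y ^ j.2) := by
          rw [Finset.sum_product_right]
          refine Finset.sum_congr rfl fun b _ => ?_
          simp only [p, map_sum, Finset.sum_mul, aeval_monomial, ← Algebra.smul_def,
            smul_mul_assoc]
      _ = ∑ j ∈ s, g' j • (w ^ j.1 * y ^ j.2) :=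
          (Finset.sum_subset hsub fun j _ hj => by simp [g', hj]).symm
      _ = ∑ j ∈ s, g j • (w ^ j.1 * y ^ j.2) :=
          Finset.sum_congr rfl fun j hj => by simp [g', hj]
  have h0 := coeff_eq_zero_of_sum_mul_pow_eq_zero hc hy hwy N p hsum i.2 (hN i hi).2
  have h1 := congrArg (fun q => coeff q i.1) h0
  simpa [p, finsetSum_coeff, coeff_monomial, g', hi, (hN i hi).1] using h1

/-- An additive subgroup stable under `c` and containing `w ^ i * y ^ m` for `i ≤ M` contains
all `w ^ a * (w - b c) ^ k * y ^ m` with `a + k ≤ M`. -/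
theorem shifted_monomial_mem (S : AddSubgroup D) (hS : ∀ x ∈ S, c • x ∈ S) (M m b : ℕ)
    (hM : ∀ i ≤ M, w ^ i * y ^ m ∈ S) (k : ℕ) :
    ∀ a, a + k ≤ M → w ^ a * (w - b • (c • 1)) ^ k * y ^ m ∈ S := by
  induction k with
  | zero => intro a ha; simpa using hM a ha
  | succ k ih =>
    intro a ha
    have h1 := ih (a + 1) (by omega)
    have h2 := S.nsmul_mem (hS _ (ih a (by omega))) b
    have : w ^ a * (w - b • (c • 1)) ^ (k + 1) * y ^ m =
        w ^ (a + 1) * (w - b • (c • 1)) ^ k * y ^ m -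
          b • (c • (w ^ a * (w - b • (c • 1)) ^ k * y ^ m)) := by
      rw [pow_succ' _ k, pow_succ w a]
      simp only [sub_mul, mul_sub, smul_mul_assoc, mul_smul_comm, one_mul, mul_assoc]
    rw [this]
    exact S.sub_mem h1 h2

/-- Only stability under `c` is required, not under `K`: besides the spans `boxSpan`, this is
applied to the subgroup on which a derivation of `K` acts coefficientwise, which need not be a
`K`-subspace. -/
theorem monomial_mul_monomial_mem (hwy : w * y = y * w + c • y) (S : AddSubgroup D)
    (hS : ∀ x ∈ S, c • x ∈ S) (a b k e : ℕ) (hM : ∀ i ≤ a + k, w ^ i * y ^ (b + e) ∈ S) :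
    w ^ a * y ^ b * (w ^ k * y ^ e) ∈ S := by
  have := shifted_monomial_mem S hS (a + k) (b + e) b hM k a le_rfl
  rwa [pow_add, ← mul_assoc _ (y ^ b), mul_assoc (w ^ a), ← pow_mul_eq_sub_mul_pow hwy,
    mul_assoc (w ^ a), mul_assoc (y ^ b), ← mul_assoc (w ^ a)] at this

variable (K) in
/-- The span of the monomials `w ^ a * y ^ b` with `a, b < n`. -/
def boxSpan (w y : D) (n : ℕ) : Submodule K D :=
  Submodule.span K (Set.range fun i : Fin n × Fin n => w ^ (i.1 : ℕ) * y ^ (i.2 : ℕ))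

theorem monomial_mem_boxSpan {a b n : ℕ} (ha : a < n) (hb : b < n) :
    w ^ a * y ^ b ∈ boxSpan K w y n :=
  Submodule.subset_span ⟨(⟨a, ha⟩, ⟨b, hb⟩), rfl⟩

theorem boxSpan_mono {m n : ℕ} (hmn : m ≤ n) : boxSpan K w y m ≤ boxSpan K w y n := by
  refine Submodule.span_le.2 ?_
  rintro _ ⟨i, rfl⟩
  exact monomial_mem_boxSpan (i.1.2.trans_le hmn) (i.2.2.trans_le hmn)

theorem mem_boxSpan_of_mem_span {p : D}
    (hp : p ∈ Submodule.span K (Set.range fun i : ℕ × ℕ => w ^ i.1 * y ^ i.2)) :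
    ∃ n, p ∈ boxSpan K w y n := by
  induction hp using Submodule.span_induction with
  | mem x hx =>
    obtain ⟨i, rfl⟩ := hx
    exact ⟨i.1 + i.2 + 1, monomial_mem_boxSpan (by omega) (by omega)⟩
  | zero => exact ⟨0, zero_mem _⟩
  | add x z _ _ hx hz =>
    obtain ⟨m, hm⟩ := hx
    obtain ⟨n, hn⟩ := hz
    exact ⟨m + n, add_mem (boxSpan_mono (by omega) hm) (boxSpan_mono (by omega) hn)⟩
  | smul k x _ hx =>
    obtain ⟨m, hm⟩ := hx
    exact ⟨m, Submodule.smul_mem _ _ hm⟩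

theorem boxSpan_mul_mem (hwy : w * y = y * w + c • y) {m n : ℕ} {p q : D}
    (hp : p ∈ boxSpan K w y m) (hq : q ∈ boxSpan K w y n) : p * q ∈ boxSpan K w y (m + n) := by
  induction hp using Submodule.span_induction with
  | mem x hx =>
    obtain ⟨i, rfl⟩ := hx
    induction hq using Submodule.span_induction with
    | mem z hz =>
      obtain ⟨j, rfl⟩ := hz
      exact monomial_mul_monomial_mem hwy (boxSpan K w y (m + n)).toAddSubgroup
        (fun x hx => Submodule.smul_mem _ _ hx) _ _ _ _ fun k hk =>
        monomial_mem_boxSpan (by omega) (by omega)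
    | zero => rw [mul_zero]; exact zero_mem _
    | add x z _ _ hx hz => rw [mul_add]; exact add_mem hx hz
    | smul k x _ hx => rw [mul_smul_comm]; exact Submodule.smul_mem _ _ hx
  | zero => rw [zero_mul]; exact zero_mem _
  | add x z _ _ hx hz => rw [add_mul]; exact add_mem hx hz
  | smul k x _ hx => rw [smul_mul_assoc]; exact Submodule.smul_mem _ _ hx

variable (K) in
/-- The algebra spanned by the monomials `w ^ a * y ^ b`. -/
def shiftAlgebra (hwy : w * y = y * w + c • y) : Subalgebra K D :=
  Submodule.toSubalgebra (Submodule.span K (Set.range fun i : ℕ × ℕ => w ^ i.1 * y ^ i.2))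
    (Submodule.subset_span ⟨(0, 0), by simp⟩) fun p q hp hq => by
      obtain ⟨m, hm⟩ := mem_boxSpan_of_mem_span hp
      obtain ⟨n, hn⟩ := mem_boxSpan_of_mem_span hq
      refine (Submodule.span_mono ?_ : boxSpan K w y (m + n) ≤ _) (boxSpan_mul_mem hwy hm hn)
      rintro _ ⟨i, rfl⟩
      exact ⟨((i.1 : ℕ), (i.2 : ℕ)), rfl⟩

theorem mem_shiftAlgebra (hwy : w * y = y * w + c • y) (p : D) : p ∈ shiftAlgebra K hwy ↔
    p ∈ Submodule.span K (Set.range fun i : ℕ × ℕ => w ^ i.1 * y ^ i.2) := Iff.rfl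

/-- The left Ore condition, by comparing dimensions. -/
theorem shiftAlgebra_ore [CharZero K] (hc : c ≠ 0) (hy : y ≠ 0) (hwy : w * y = y * w + c • y) (p : D)
    (hp : p ∈ shiftAlgebra K hwy) (q : D) (hq : q ∈ shiftAlgebra K hwy) (hq0 : q ≠ 0) :
    ∃ p' ∈ shiftAlgebra K hwy, ∃ q' ∈ shiftAlgebra K hwy, q' ≠ 0 ∧ q' * p = p' * q := by
  obtain ⟨d, hpd, hqd⟩ : ∃ d, p ∈ boxSpan K w y d ∧ q ∈ boxSpan K w y d := by
    obtain ⟨m, hm⟩ := mem_boxSpan_of_mem_span hp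
    obtain ⟨n, hn⟩ := mem_boxSpan_of_mem_span hq
    exact ⟨m + n, boxSpan_mono (by omega) hm, boxSpan_mono (by omega) hn⟩
  -- Chosen so that `2 n ^ 2 > (n + d) ^ 2`: the map `(u, v) ↦ u p - v q` from two copies of an
  -- `n`-box to an `(n + d)`-box then has a kernel.
  let n := 3 * d + 3
  let v : Fin n × Fin n → D := fun i => w ^ (i.1 : ℕ) * y ^ (i.2 : ℕ)
  have hv : LinearIndependent K v :=
    (linearIndependent_monomials hc hy hwy).comp
      (fun i : Fin n × Fin n => ((i.1 : ℕ), (i.2 : ℕ))) (by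
        rintro ⟨a, b⟩ ⟨a', b'⟩ hab
        simp only [Prod.mk.injEq, Fin.val_inj] at hab ⊢
        exact hab)
  let e := Fintype.linearCombination K v
  have he : ∀ f, e f ∈ boxSpan K w y n := by
    intro f
    rw [Fintype.linearCombination_apply]
    exact sum_mem fun i _ => Submodule.smul_mem _ _ (Submodule.subset_span ⟨i, rfl⟩)
  have heA : ∀ f, e f ∈ shiftAlgebra K hwy := by
    intro f
    rw [mem_shiftAlgebra, Fintype.linearCombination_apply]
    exact sum_mem fun i _ => Submodule.smul_mem _ _
      (Submodule.subset_span ⟨((i.1 : ℕ), (i.2 : ℕ)), rfl⟩)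
  have he0 : ∀ f, e f = 0 → f = 0 := fun f hf =>
    (injective_iff_map_eq_zero e).1 (LinearIndependent.fintypeLinearCombination_injective hv) f hf
  let T : ((Fin n × Fin n → K) × (Fin n × Fin n → K)) →ₗ[K] boxSpan K w y (n + d) :=
    LinearMap.codRestrict _
      (((LinearMap.mulRight K p).comp e).coprod (-((LinearMap.mulRight K q).comp e))) fun f => by
        simp only [LinearMap.coprod_apply, LinearMap.comp_apply, LinearMap.neg_apply,
          LinearMap.mulRight_apply]
        exact add_mem (boxSpan_mul_mem hwy (he _) hpd) (neg_mem (boxSpan_mul_mem hwy (he _) hqd))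
  have hfin : FiniteDimensional K (boxSpan K w y (n + d)) :=
    FiniteDimensional.span_of_finite K (Set.finite_range _)
  have hrank : Module.finrank K (boxSpan K w y (n + d)) <
      Module.finrank K ((Fin n × Fin n → K) × (Fin n × Fin n → K)) := by
    have h1 : Module.finrank K (boxSpan K w y (n + d)) ≤ (n + d) * (n + d) := by
      refine (finrank_range_le_card _).trans ?_
      simp
    refine h1.trans_lt ?_
    rw [Module.finrank_prod, Module.finrank_fintype_fun_eq_card]
    simp only [Fintype.card_prod, Fintype.card_fin, n]
    nlinarith
  obtain ⟨f, hf, hf0⟩ := (Submodule.ne_bot_iff _).1 (LinearMap.ker_ne_bot_of_finrank_lt (f := T) hrank)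
  have hT : e f.1 * p = e f.2 * q := by
    have := congrArg Subtype.val (LinearMap.mem_ker.1 hf)
    simp only [T, LinearMap.codRestrict_apply, LinearMap.coprod_apply, LinearMap.comp_apply,
      LinearMap.neg_apply, LinearMap.mulRight_apply, Submodule.coe_zero] at this
    rwa [← sub_eq_add_neg, sub_eq_zero] at this
  refine ⟨e f.2, heA _, e f.1, heA _, fun h0 => hf0 ?_, hT⟩
  rw [h0, zero_mul] at hT
  exact Prod.ext (he0 _ h0) (he0 _ ((mul_eq_zero.1 hT.symm).resolve_right hq0))

/-- A derivation of the central field `K` extends to the skew field generated over `K` by `w, y`,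
with value zero on `w, y`. -/
theorem exists_derivation_of_shift [CharZero K] (hc : c ≠ 0) (hy : y ≠ 0) (hwy : w * y = y * w + c • y)
    (hgen : Subfield.closure (Set.range (algebraMap K D) ∪ {w, y}) = ⊤)
    (d : K →+ K) (hd : ∀ a b, d (a * b) = d a * b + a * d b) (hdc : d c = 0) :
    ∃ Δ : D →+ D, (∀ a b, Δ (a * b) = Δ a * b + a * Δ b) ∧
      (∀ k, Δ (algebraMap K D k) = algebraMap K D (d k)) ∧ Δ w = 0 ∧ Δ y = 0 := by
  have hd1 : d 1 = 0 := by simpa using hd 1 1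
  have hli := linearIndependent_monomials (K := K) hc hy hwy
  set v : ℕ × ℕ → D := fun i => w ^ i.1 * y ^ i.2 with hv
  -- The monomials are completed to a `K`-basis of `D` only to have `δ` defined everywhere; it
  -- differentiates coordinates, and the Leibniz rule is claimed only on the span of the monomials.
  let B := Module.Basis.extend hli.linearIndepOn_id
  let δ : D →+ D := (Finsupp.liftAddHom fun e =>
    ((smulAddHom K D).flip (B e)).comp d).comp B.repr.toLinearMap.toAddMonoidHom
  have hδB : ∀ e k, δ (k • B e) = d k • B e := by
    intro e k
    simp [δ]
  have hδv : ∀ i k, δ (k • v i) = d k • v i := by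
    intro i k
    have := hδB ⟨v i, Module.Basis.subset_extend hli.linearIndepOn_id ⟨i, rfl⟩⟩ k
    rwa [Module.Basis.extend_apply_self] at this
  -- The elements that behave as constants for `δ`. Products of monomials belong to it because
  -- rewriting them introduces only the scalar `c`, and `d c = 0`.
  let S : AddSubgroup D :=
    { carrier := {x | ∀ k : K, δ (k • x) = d k • x}
      zero_mem' := fun k => by simp
      add_mem' := fun hx hz k => by rw [smul_add, map_add, hx k, hz k, smul_add]
      neg_mem' := fun hx k => by rw [smul_neg, map_neg, hx k, smul_neg] }
  have hSv : ∀ i j, v i * v j ∈ S := fun i j =>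
    monomial_mul_monomial_mem hwy S (fun x hx k => by
      rw [smul_smul, hx (k * c), hd, hdc, mul_zero, add_zero, mul_smul]) _ _ _ _
      fun k _ => hδv (k, i.2 + j.2)
  have hδ1 : ∀ i (k : K), ∀ b ∈ shiftAlgebra K hwy, ∀ l : K,
      δ (k • v i * (l • b)) = δ (k • v i) * (l • b) + k • v i * δ (l • b) := by
    intro i k b hb
    rw [mem_shiftAlgebra] at hb
    induction hb using Submodule.span_induction with
    | mem x hx =>
      obtain ⟨j, rfl⟩ := hx
      intro l
      rw [smul_mul_smul_comm, hSv i j (k * l), hδv, hδv, hd, smul_mul_smul_comm,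
        smul_mul_smul_comm, add_smul]
    | zero => simp
    | add x z _ _ hx hz =>
      intro l
      rw [smul_add, mul_add, map_add, hx l, hz l, map_add, mul_add, mul_add]; abel
    | smul m x _ hx =>
      intro l
      rw [smul_smul]
      exact hx (l * m)
  have hδ2 : ∀ a ∈ shiftAlgebra K hwy, ∀ k : K, ∀ b ∈ shiftAlgebra K hwy,
      δ (k • a * b) = δ (k • a) * b + k • a * δ b := by
    intro a ha
    rw [mem_shiftAlgebra] at ha
    induction ha using Submodule.span_induction with
    | mem x hx =>
      obtain ⟨i, rfl⟩ := hx
      intro k b hb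
      simpa using hδ1 i k b hb 1
    | zero => simp
    | add x z _ _ hx hz =>
      intro k b hb
      rw [smul_add, add_mul, map_add, hx k b hb, hz k b hb, map_add, add_mul, add_mul]; abel
    | smul m x _ hx =>
      intro k b hb
      rw [smul_smul]
      exact hx (k * m) b hb
  let A : Subring D := (shiftAlgebra K hwy).toSubring
  have hδ : ∀ a ∈ A, ∀ b ∈ A, δ (a * b) = δ a * b + a * δ b := fun a ha b hb => by
    simpa using hδ2 a ha 1 b hb
  have hwA : w ∈ A := Submodule.subset_span ⟨(1, 0), by simp⟩
  have hyA : y ∈ A := Submodule.subset_span ⟨(0, 1), by simp⟩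
  have hden : ∀ x : D, ∃ q ∈ A, q ≠ 0 ∧ q * x ∈ A := by
    intro x
    refine exists_left_denominator A (fun p hp q hq hq0 => shiftAlgebra_ore hc hy hwy p hp q hq hq0)
      x ((Subfield.closure_mono ?_ : Subfield.closure (Set.range (algebraMap K D) ∪ {w, y}) ≤ _)
        (by rw [hgen]; trivial))
    rintro _ (⟨k, rfl⟩ | rfl | rfl)
    · exact (shiftAlgebra K hwy).algebraMap_mem k
    · exact hwA
    · exact hyA
  obtain ⟨Δ, hΔ, hΔA⟩ := exists_derivation_of_left_denominators A hden δ hδ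
  refine ⟨Δ, hΔ, fun k => ?_, ?_, ?_⟩
  · rw [hΔA _ ((shiftAlgebra K hwy).algebraMap_mem k)]
    simpa [hv, Algebra.algebraMap_eq_smul_one] using hδv (0, 0) k
  · rw [hΔA _ hwA]
    simpa [hv, hd1] using hδv (1, 0) 1
  · rw [hΔA _ hyA]
    simpa [hv, hd1] using hδv (0, 1) 1

end ShiftAlgebra

/-! ### The generators in a skew field extension -/

/-- Exchanging the indices gives an equivalent relation modulo the `x y` relations, so the order on
`I` no longer matters. -/
theorem HAlg.xx_all {h : ℂ} {I : Type*} [LinearOrder I] (i j : I) : (x j * x i : HAlg h I) =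
    x i * x j - h • (x i * y j) + h • (y i * x j) + h ^ 2 • (y i * y j) := by
  rcases lt_trichotomy i j with hij | rfl | hij
  · exact xx i j hij
  · rw [xy i i]; module
  · rw [xx j i hij, xy i j, xy j i, yy j i]
    simp only [smul_add]
    module

namespace SkewExt

variable {h : ℂ} {I : Type*} [LinearOrder I] {D : Type*} [DivisionRing D] [Algebra ℂ D]
  (S : SkewExt h I D)

/-- The image of `x_i`. -/
noncomputable def gx (i : I) : D := S.ι (HAlg.x i)

/-- The image of `y_i`. -/
noncomputable def gy (i : I) : D := S.ι (HAlg.y i)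

theorem gyy (i j : I) : S.gy i * S.gy j = S.gy j * S.gy i := by
  simp only [gy, ← map_mul, HAlg.yy i j]

theorem gxy (i j : I) : S.gx i * S.gy j = S.gy j * S.gx i + h • (S.gy j * S.gy i) := by
  simp only [gx, gy, ← map_mul, HAlg.xy i j, map_add, map_smul]

theorem gxx (i j : I) : S.gx j * S.gx i = S.gx i * S.gx j - h • (S.gx i * S.gy j) +
    h • (S.gy i * S.gx j) + h ^ 2 • (S.gy i * S.gy j) := by
  simp only [gx, gy, ← map_mul, HAlg.xx_all i j, map_add, map_sub, map_smul]

/-- The map to `ℂ[ε]` with all `x_i ↦ 0` and `y_i ↦ ε` respects the relations, since they are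
quadratic, and it detects `y_j`. -/
theorem gy_ne_zero (j : I) : S.gy j ≠ 0 := by
  intro h0
  have h1 : (HAlg.y j : HAlg h I) = 0 := S.ι_injective (by rw [map_zero]; exact h0)
  let f : HAlg h I →ₐ[ℂ] DualNumber ℂ := HAlg.lift (fun _ => 0) (fun _ => DualNumber.eps)
    (fun _ _ => rfl) (fun _ _ => by simp) (fun _ _ _ => by simp)
  have h2 : f (HAlg.y j) = DualNumber.eps := HAlg.lift_y _ _ _ _ _ j
  rw [h1, map_zero] at h2
  simpa using congrArg TrivSqZeroExt.snd h2

@[simp] theorem expF_gx (i : I) : S.expF (S.gx i) = S.gx i + h • S.gy i := by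
  simp [gx, gy, S.expF_ι]

@[simp] theorem expF_gy (i : I) : S.expF (S.gy i) = S.gy i := by
  simp [gy, S.expF_ι]

@[simp] theorem expF_symm_gy (i : I) : S.expF.symm (S.gy i) = S.gy i := by
  rw [AlgEquiv.symm_apply_eq, expF_gy]

@[simp] theorem expF_symm_gx (i : I) : S.expF.symm (S.gx i) = S.gx i - h • S.gy i := by
  rw [AlgEquiv.symm_apply_eq]; simp

@[simp] theorem H_gx (i : I) : S.H (S.gx i) = S.gx i := by simp [gx, S.H_ι]

@[simp] theorem H_gy (i : I) : S.H (S.gy i) = -S.gy i := by simp [gy, S.H_ι]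

theorem H_one : S.H 1 = 0 := by
  have := S.H_ι 1
  rwa [map_one, HAlg.H_one, map_zero] at this

/-- The central elements `(j i)` of `H_I`. -/
noncomputable def det (j i : I) : D := S.gy j * S.gx i - S.gy i * S.gx j

theorem det_mul_gy (j i k : I) : S.det j i * S.gy k = S.gy k * S.det j i := by
  simp only [det]
  linear_combination (norm := skip) S.gy j * S.gxy i k - S.gy i * S.gxy j k +
    S.gyy j k * S.gx i - S.gyy i k * S.gx j + h • (S.gyy j k * S.gy i) - h • (S.gyy i k * S.gy j)
    + h • (S.gy k * S.gyy j i)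
  simp only [mul_add, mul_sub, sub_mul, mul_smul_comm, mul_assoc]
  module

theorem det_mul_gx (j i k : I) : S.det j i * S.gx k = S.gx k * S.det j i := by
  simp only [det]
  linear_combination (norm := skip) - S.gxy k j * S.gx i + S.gxy k i * S.gx j
    - S.gy j * S.gxx i k + S.gy i * S.gxx j k + h • (S.gy j * S.gxy i k) - h • (S.gy i * S.gxy j k)
    - h • (S.gyy j i * S.gx k) + (h * h) • (S.gy j * S.gyy k i)
    - (h * h) • (S.gy i * S.gyy k j)
  simp only [mul_add, add_mul, mul_sub, sub_mul, smul_mul_assoc, mul_smul_comm, mul_assoc, smul_add,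
    smul_smul, pow_two]
  module

/-- Derivations of `H_I` into `D` from values on the generators. -/
theorem exists_derivation_HAlg (p q : I → D)
    (hqy : ∀ i k, q i * S.gy k = S.gy k * q i)
    (hpy : ∀ i k, p i * S.gy k = S.gy k * p i + h • (S.gy k * q i))
    (hxq : ∀ i k, S.gx k * q i = q i * S.gx k + h • (q i * S.gy k))
    (hpx : ∀ i k, p i * S.gx k = S.gx k * p i - h • (S.gx k * q i) + h • (S.gy k * p i) +
      h ^ 2 • (S.gy k * q i))
    (hxp : ∀ i k, S.gx k * p i = p i * S.gx k - h • (p i * S.gy k) + h • (q i * S.gx k) +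
      h ^ 2 • (q i * S.gy k)) :
    ∃ δ : HAlg h I →ₗ[ℂ] D, (∀ a b, δ (a * b) = δ a * S.ι b + S.ι a * δ b) ∧
      (∀ i, δ (HAlg.x i) = p i) ∧ ∀ i, δ (HAlg.y i) = q i := by
  -- The off-diagonal entry of an upper triangular homomorphism with both diagonal entries `ι` is a
  -- derivation. The hypotheses are the relations with one factor differentiated.
  let M : HAlg h I →ₐ[ℂ] Matrix (Fin 2) (Fin 2) D :=
    HAlg.lift (fun i => !![S.gx i, p i; 0, S.gx i]) (fun i => !![S.gy i, q i; 0, S.gy i])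
      (fun i j => by
        ext a b; fin_cases a <;> fin_cases b <;> simp [S.gyy i j]
        rw [hqy i j, ← hqy j i, add_comm])
      (fun i j => by
        ext a b; fin_cases a <;> fin_cases b <;> simp [S.gxy i j]
        rw [hpy i j, hxq j i]; module)
      (fun i j _ => by
        ext a b; fin_cases a <;> fin_cases b <;> simp [S.gxx i j]
        rw [hpx j i, hxp i j]; module)
  have hM : ∀ a, M a 0 0 = S.ι a ∧ M a 1 1 = S.ι a ∧ M a 1 0 = 0 := by
    intro a
    induction a using HAlg.induction with
    | hc c => simp [Matrix.algebraMap_matrix_apply]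
    | hx i => simp [M, gx]
    | hy i => simp [M, gy]
    | ha a b pa pb => simp [pa, pb]
    | hm a b pa pb => simp [Matrix.mul_apply, pa, pb]
  refine ⟨(Matrix.entryLinearMap ℂ D 0 1).comp M.toLinearMap, fun a b => ?_, fun i => ?_,
    fun i => ?_⟩
  · simp [Matrix.mul_apply, hM, add_comm]
  · simp [M]
  · simp [M]

end SkewExt

/-! ### Commutation rules in `D` and central elements -/

namespace CentralExt

variable {h : ℂ} {I : Type*} [LinearOrder I] {o : I} {D : Type*} [DivisionRing D] [Algebra ℂ D]
  (S : CentralExt h o D)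

theorem induction {P : D → Prop} (hc : ∀ c : ℂ, P (algebraMap ℂ D c)) (hx : ∀ i, P (S.gx i))
    (hy : ∀ i, P (S.gy i)) (hr : ∀ s ∈ S.roots, P s) (ha : ∀ a b, P a → P b → P (a + b))
    (hm : ∀ a b, P a → P b → P (a * b)) (hi : ∀ a, a ≠ 0 → P a → P a⁻¹) (d : D) : P d := by
  have hd : d ∈ Subfield.closure (Set.range S.ι ∪ S.roots) := by rw [S.generates]; trivial
  induction hd using Subfield.closure_induction with
  | mem d hd =>
    rcases hd with ⟨a, rfl⟩ | hd
    · induction a using HAlg.induction with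
      | hc c => rw [AlgHom.commutes]; exact hc c
      | hx i => exact hx i
      | hy i => exact hy i
      | ha a b pa pb => rw [map_add]; exact ha _ _ pa pb
      | hm a b pa pb => rw [map_mul]; exact hm _ _ pa pb
    · exact hr d hd
  | one => simpa using hc 1
  | add a b _ _ pa pb => exact ha _ _ pa pb
  | neg a _ pa =>
    have := hm _ _ (hc (-1)) pa
    rwa [map_neg, map_one, neg_one_mul] at this
  | mul a b _ _ pa pb => exact hm _ _ pa pb
  | inv a _ pa =>
    by_cases h0 : a = 0
    · rw [h0, inv_zero]; simpa using hc 0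
    · exact hi a h0 pa

theorem coeffs_induction {P : D → Prop} (hc : ∀ c : ℂ, P (algebraMap ℂ D c))
    (hx : ∀ i, i ≠ o → P (S.gx i)) (hy : ∀ i, i ≠ o → P (S.gy i)) (hr : ∀ s ∈ S.roots, P s)
    (ha : ∀ a b, P a → P b → P (a + b)) (hm : ∀ a b, P a → P b → P (a * b))
    (hi : ∀ a, a ≠ 0 → P a → P a⁻¹) (d : D) (hd : d ∈ S.coeffs) : P d := by
  have key : ∀ a ∈ HAlg.sub h o, P (S.ι a) := by
    intro a ha'
    rw [HAlg.sub] at ha'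
    induction ha' using Algebra.adjoin_induction with
    | mem a ha =>
      obtain ⟨i, hio, rfl | rfl⟩ := ha
      · exact hx i hio
      · exact hy i hio
    | algebraMap c => rw [AlgHom.commutes]; exact hc c
    | add a b _ _ pa pb => rw [map_add]; exact ha _ _ pa pb
    | mul a b _ _ pa pb => rw [map_mul]; exact hm _ _ pa pb
  rw [coeffs] at hd
  induction hd using Subfield.closure_induction with
  | mem d hd =>
    rcases hd with ⟨a, hd, rfl⟩ | hd
    · exact key a hd
    · exact hr d hd
  | one => simpa using hc 1
  | add a b _ _ pa pb => exact ha _ _ pa pb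
  | neg a _ pa =>
    have := hm _ _ (hc (-1)) pa
    rwa [map_neg, map_one, neg_one_mul] at this
  | mul a b _ _ pa pb => exact hm _ _ pa pb
  | inv a _ pa =>
    by_cases h0 : a = 0
    · rw [h0, inv_zero]; simpa using hc 0
    · exact hi a h0 pa

/-- Elements commuting with the coordinates are central. -/
theorem commute_of_commute_coords {v : D} (hx : ∀ i, Commute v (S.gx i))
    (hy : ∀ i, Commute v (S.gy i)) (d : D) : Commute v d :=
  S.induction (P := fun d => Commute v d) (fun c => Algebra.commutes' c v |>.symm) hx hy
    (fun s hs => (S.roots_central s hs v).symm) (fun _ _ => Commute.add_right)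
    (fun _ _ => Commute.mul_right) (fun _ _ => Commute.inv_right₀) d

/-- The automorphism `e^{hF}` is inner: it is conjugation by any `y_k`. Both are multiplicative, so
coordinates and roots suffice. -/
theorem gy_mul_expF (k : I) (a : D) : S.gy k * S.expF a = a * S.gy k := by
  induction a using S.induction with
  | hc c => rw [AlgEquiv.commutes, Algebra.commutes]
  | hx i => rw [S.expF_gx, S.gxy, mul_add, mul_smul_comm]
  | hy i => rw [S.expF_gy, S.gyy]
  | hr s hs => rw [(S.roots_inv s hs).2.2.2, S.roots_central s hs]
  | ha a b pa pb => rw [map_add, mul_add, add_mul, pa, pb]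
  | hm a b pa pb => rw [map_mul, ← mul_assoc, pa, mul_assoc, pb, mul_assoc]
  | hi a h0 pa =>
    rw [map_inv₀, eq_inv_mul_iff_mul_eq₀ h0, ← mul_assoc, ← pa, mul_assoc,
      mul_inv_cancel₀ (by simpa using h0), mul_one]

theorem gy_mul (k : I) (a : D) : S.gy k * a = S.expF.symm a * S.gy k := by
  rw [← S.gy_mul_expF, AlgEquiv.apply_symm_apply]

/-- The twisted Leibniz rule of `H` matches the way `x_k` passes a product, so the formula follows
from coordinates and roots. It makes elements on which `H` and `e^{hF}` act trivially commute with
every `x_k`. -/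
theorem gx_mul (k : I) (a : D) : S.gx k * a = S.expF a * S.gx k +
    (-(h • S.H a) + (h / 2) • (S.expF a - S.expF.symm a)) * S.gy k := by
  induction a using S.induction with
  | hc c =>
    have : S.H (algebraMap ℂ D c) = 0 := by
      rw [Algebra.algebraMap_eq_smul_one, map_smul, S.H_one, smul_zero]
    rw [this, AlgEquiv.commutes, AlgEquiv.commutes, Algebra.commutes]
    simp
  | hx i =>
    rw [S.expF_gx, S.expF_symm_gx, S.H_gx, S.gxx]
    simp only [add_mul, sub_mul, smul_mul_assoc, smul_add, smul_sub, neg_mul]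
    module
  | hy i =>
    rw [S.expF_gy, S.expF_symm_gy, S.H_gy, S.gxy]
    simp
  | hr s hs =>
    obtain ⟨-, -, h1, h2⟩ := S.roots_inv s hs
    have h3 : S.expF.symm s = s := by rw [AlgEquiv.symm_apply_eq, h2]
    rw [h1, h2, h3, S.roots_central s hs]
    simp
  | ha a b pa pb =>
    rw [mul_add, pa, pb]
    simp only [map_add, add_mul, smul_add, smul_sub, sub_mul, neg_add, neg_mul]
    abel
  | hm a b pa pb =>
    rw [← mul_assoc, pa, add_mul, mul_assoc, pb, mul_assoc _ (S.gy k), S.gy_mul, S.H_mul, map_mul,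
      map_mul]
    simp only [add_mul, mul_add, sub_mul, mul_sub, smul_mul_assoc, mul_smul_comm, smul_add,
      smul_sub, mul_assoc, neg_mul, mul_neg]
    module
  | hi a h0 pa =>
    have h1 := S.H_mul a a⁻¹
    rw [mul_inv_cancel₀ h0, S.H_one] at h1
    have h2 : S.expF a ≠ 0 := by simpa using h0
    refine mul_left_cancel₀ h2 ?_
    have h3 : S.H a⁻¹ = -((S.expF a)⁻¹ * (S.H a * S.expF.symm a⁻¹)) := by
      rw [eq_neg_iff_add_eq_zero]
      refine mul_left_cancel₀ h2 ?_
      rw [mul_zero, mul_add, ← mul_assoc, ← mul_assoc, mul_inv_cancel₀ h2, one_mul, add_comm]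
      exact h1.symm
    have h4 : S.expF a * S.gx k = S.gx k * a -
        (-(h • S.H a) + (h / 2) • (S.expF a - S.expF.symm a)) * S.gy k := by rw [pa]; abel
    rw [← mul_assoc, h4, sub_mul, mul_assoc, mul_inv_cancel₀ h0, mul_assoc _ (S.gy k), S.gy_mul,
      mul_add, h3, map_inv₀, map_inv₀]
    have h5 : S.expF.symm a ≠ 0 := by simpa using h0
    simp only [add_mul, mul_add, sub_mul, mul_sub, smul_mul_assoc, mul_smul_comm,
      smul_sub, neg_mul, smul_neg, neg_neg, mul_inv_cancel_left₀ h2,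
      mul_inv_cancel_left₀ h5, mul_assoc, mul_one]
    module

/-- Invariants are central. -/
theorem Inv.commute {v : D} (hv : S.Inv v) (d : D) : Commute v d := by
  obtain ⟨-, -, h1, h2⟩ := hv
  have h3 : S.expF.symm v = v := by rw [AlgEquiv.symm_apply_eq, h2]
  refine S.commute_of_commute_coords (fun i => ?_) (fun i => ?_) d
  · have := S.gx_mul i v
    rw [h1, h2, h3] at this
    exact Eq.symm (by simpa using this)
  · have := S.gy_mul i v
    rw [h3] at this
    exact this.symm

theorem det_commute (j i : I) (d : D) : Commute (S.det j i) d :=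
  S.commute_of_commute_coords (fun k => S.det_mul_gx j i k) (fun k => S.det_mul_gy j i k) d

/-- The ratio of `y_i` and `y_j` is central. -/
theorem ratio_commute (j i : I) (d : D) : Commute ((S.gy j)⁻¹ * S.gy i) d := by
  have h0 := S.gy_ne_zero j
  have : S.expF.symm d * S.gy j = S.gy j * d := (S.gy_mul j d).symm
  change (S.gy j)⁻¹ * S.gy i * d = d * ((S.gy j)⁻¹ * S.gy i)
  refine mul_left_cancel₀ h0 ?_
  rw [mul_assoc, mul_inv_cancel_left₀ h0, S.gy_mul i, ← mul_assoc, S.gy_mul j d, mul_assoc,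
    mul_inv_cancel_left₀ h0]

end CentralExt

/-! ### Derivations of skew fields -/

section Derivation

variable {D : Type*} [DivisionRing D]

/-- The skew subfield of elements annihilated by a derivation. -/
def derivationKer (Δ : D →+ D) (hΔ : ∀ a b, Δ (a * b) = Δ a * b + a * Δ b) : Subfield D where
  carrier := {a | Δ a = 0}
  zero_mem' := map_zero Δ
  one_mem' := by simpa using hΔ 1 1
  add_mem' := fun {a b} (ha : Δ a = 0) (hb : Δ b = 0) => by
    change Δ (a + b) = 0
    rw [map_add, ha, hb, add_zero]
  neg_mem' := fun {a} (ha : Δ a = 0) => by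
    change Δ (-a) = 0
    rw [map_neg, ha, neg_zero]
  mul_mem' := fun {a b} (ha : Δ a = 0) (hb : Δ b = 0) => by
    change Δ (a * b) = 0
    rw [hΔ, ha, hb, zero_mul, mul_zero, add_zero]
  inv_mem' := fun a (ha : Δ a = 0) => by
    change Δ a⁻¹ = 0
    by_cases h0 : a = 0
    · simp [h0]
    · have h1 := hΔ a a⁻¹
      have h2 : Δ 1 = 0 := by simpa using hΔ 1 1
      rw [mul_inv_cancel₀ h0, ha, zero_mul, zero_add, h2] at h1
      exact (mul_eq_zero.1 h1.symm).resolve_left h0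

theorem mem_derivationKer {Δ : D →+ D} {hΔ : ∀ a b, Δ (a * b) = Δ a * b + a * Δ b} {a : D} :
    a ∈ derivationKer Δ hΔ ↔ Δ a = 0 := Iff.rfl

/-- Differentiate `s d = d s` and cancel the terms containing `Δ d`. -/
theorem derivation_commute {Δ : D →+ D} (hΔ : ∀ a b, Δ (a * b) = Δ a * b + a * Δ b) {s : D}
    (hs : ∀ d, Commute s d) (d : D) : Commute (Δ s) d := by
  have h1 := hΔ s d
  rw [(hs d).eq, hΔ, (hs (Δ d)).eq, add_comm] at h1
  exact (add_right_cancel h1).symm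

theorem derivation_pow {Δ : D →+ D} (hΔ : ∀ a b, Δ (a * b) = Δ a * b + a * Δ b) {s : D}
    (hs : ∀ d, Commute s d) (n : ℕ) : Δ (s ^ n) = n * s ^ (n - 1) * Δ s := by
  induction n with
  | zero => simpa using hΔ 1 1
  | succ n ih =>
    rw [pow_succ, hΔ, ih]
    rcases n with _ | n
    · simp
    · rw [mul_assoc, ← (hs (Δ s)).eq]
      simp only [Nat.add_sub_cancel, pow_succ, Nat.cast_add, Nat.cast_one]
      noncomm_ring

/-- A central element that is algebraic over the elements annihilated by a derivation is itself
annihilated by it. -/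
theorem derivation_eq_zero_of_isRoot [CharZero D] {Δ : D →+ D}
    (hΔ : ∀ a b, Δ (a * b) = Δ a * b + a * Δ b) {s : D} (hs : ∀ d, Commute s d) (n : ℕ) :
    ∀ p : Polynomial D, p.natDegree ≤ n → p ≠ 0 → (∀ m, Δ (p.coeff m) = 0) → p.eval s = 0 →
      Δ s = 0 := by
  induction n with
  | zero =>
    intro p hn hp0 _ hps
    rw [Polynomial.eq_C_of_natDegree_le_zero hn, Polynomial.eval_C] at hps
    rw [Polynomial.eq_C_of_natDegree_le_zero hn, hps] at hp0
    simp at hp0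
  | succ n ih =>
    intro p hn hp0 hpc hps
    -- This is `Δ (p(s)) = 0`, since the coefficients are constants. Either `Δ s = 0` or `s` is a
    -- root of `p'`, which has smaller degree.
    have h1 : p.derivative.eval s * Δ s = 0 := by
      rw [← map_zero Δ, ← hps, Polynomial.derivative_eval, Polynomial.eval_eq_sum,
        Polynomial.sum, Polynomial.sum, map_sum, Finset.sum_mul]
      refine Finset.sum_congr rfl fun m _ => ?_
      rw [hΔ, hpc, derivation_pow hΔ hs]
      simp [mul_assoc]
    rcases mul_eq_zero.1 h1 with h1 | h1
    · by_cases hd : p.derivative = 0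
      · exact ih p (by rw [Polynomial.derivative_eq_zero.1 hd]; omega) hp0 hpc hps
      · refine ih p.derivative ?_ hd (fun m => ?_) h1
        · exact (Polynomial.natDegree_derivative_le p).trans (by omega)
        · rw [Polynomial.coeff_derivative, hΔ, hpc, zero_mul, zero_add]
          have : ((m : D) + 1) ∈ derivationKer Δ hΔ := add_mem (natCast_mem _ m) (one_mem _)
          rw [mem_derivationKer.1 this, mul_zero]
    · exact h1

end Derivation

/-! ### Existence of the polarization derivation -/

namespace CentralExt

variable {h : ℂ} {I : Type*} [LinearOrder I] {o : I} {D : Type*} [DivisionRing D] [Algebra ℂ D]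
  (S : CentralExt h o D)

theorem Q₀_le {T : Subfield D} (hc : ∀ c : ℂ, algebraMap ℂ D c ∈ T)
    (hx : ∀ i, i ≠ o → S.gx i ∈ T) (hy : ∀ i, i ≠ o → S.gy i ∈ T) : S.Q₀ o ≤ T := by
  refine Subfield.closure_le.2 ?_
  rintro _ ⟨a, ha, rfl⟩
  have ha' : a ∈ HAlg.sub h o := ha
  clear ha
  rw [HAlg.sub] at ha'
  induction ha' using Algebra.adjoin_induction with
  | mem a ha =>
    obtain ⟨i, hio, rfl | rfl⟩ := ha
    · exact hx i hio
    · exact hy i hio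
  | algebraMap c => rw [AlgHom.commutes]; exact hc c
  | add a b _ _ pa pb => rw [map_add]; exact add_mem pa pb
  | mul a b _ _ pa pb => rw [map_mul]; exact mul_mem pa pb

/-- A derivation that vanishes on the coordinates other than `x, y` vanishes on the coefficients. -/
theorem derivation_coeffs {Δ : D →+ D} (hΔ : ∀ a b, Δ (a * b) = Δ a * b + a * Δ b)
    (hc : ∀ c : ℂ, Δ (algebraMap ℂ D c) = 0) (hx : ∀ i, i ≠ o → Δ (S.gx i) = 0)
    (hy : ∀ i, i ≠ o → Δ (S.gy i) = 0) {a : D} (ha : a ∈ S.coeffs) : Δ a = 0 := by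
  have : CharZero D := charZero_of_injective_algebraMap (algebraMap ℂ D).injective
  have hQ : S.Q₀ o ≤ derivationKer Δ hΔ := S.Q₀_le hc hx hy
  have : S.coeffs ≤ derivationKer Δ hΔ := by
    refine Subfield.closure_le.2 (Set.union_subset (Subfield.closure_le.1 hQ) fun s hs => ?_)
    obtain ⟨p, hp0, hpc, hps⟩ := S.roots_algebraic s hs
    exact derivation_eq_zero_of_isRoot hΔ (S.roots_central s hs) _ p le_rfl hp0
      (fun m => hQ (hpc m).1) hps
  exact this ha

theorem ratio_mul (j i : I) : (S.gy j)⁻¹ * S.gy i * S.gy j = S.gy i := by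
  rw [(S.ratio_commute j i _).eq, mul_inv_cancel_left₀ (S.gy_ne_zero j)]

theorem gx_mul_inv (j k : I) :
    S.gx k * (S.gy j)⁻¹ = (S.gy j)⁻¹ * S.gx k - h • ((S.gy j)⁻¹ * S.gy k) := by
  have h0 := S.gy_ne_zero j
  rw [mul_inv_eq_iff_eq_mul₀ h0, sub_mul, smul_mul_assoc, ratio_mul, mul_assoc, S.gxy k j, mul_add,
    inv_mul_cancel_left₀ h0, mul_smul_comm, inv_mul_cancel_left₀ h0]
  abel

theorem inv_mul_gy (j k : I) : (S.gy j)⁻¹ * S.gy k = S.gy k * (S.gy j)⁻¹ := by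
  rw [eq_mul_inv_iff_mul_eq₀ (S.gy_ne_zero j), ratio_mul]

/-- The derivation of `D` which vanishes on the coefficients, with prescribed central values on the
central elements `y_j⁻¹ y` and `y_j x - y x_j`. -/
theorem exists_isPolarDer (hh : h ≠ 0) {j : I} (hj : j ≠ o) {s r : D} (hs : ∀ d, Commute s d)
    (hr : ∀ d, Commute r d) :
    ∃ Δ, S.IsPolarDer (S.gx j * s + (S.gy j)⁻¹ * r) (S.gy j * s) Δ := by
  classical
  have h0 := S.gy_ne_zero j
  -- With `x_j, y_j` constant, the values `s` on `y_j⁻¹ y` and `r` on `y_j x - y x_j` force `Δ y =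
  -- y_j s` and `y_j Δ x = r + y_j s x_j`.
  set P := S.gx j * s + (S.gy j)⁻¹ * r with hP
  set Q := S.gy j * s with hQ
  have hQy : ∀ k, Q * S.gy k = S.gy k * Q := fun k => by
    rw [hQ, mul_assoc, (hs _).eq, ← mul_assoc, S.gyy j k, mul_assoc]
  have hPy : ∀ k, P * S.gy k = S.gy k * P + h • (S.gy k * Q) := fun k => by
    rw [hP, hQ, add_mul, mul_assoc, (hs _).eq, ← mul_assoc, S.gxy j k, mul_assoc _ r, (hr _).eq,
      ← mul_assoc _ _ r, S.inv_mul_gy]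
    simp only [add_mul, mul_add, mul_assoc, smul_mul_assoc]
    abel
  have hxQ : ∀ k, S.gx k * Q = Q * S.gx k + h • (Q * S.gy k) := fun k => by
    rw [hQ, mul_assoc _ s, (hs _).eq, mul_assoc _ s, (hs _).eq, ← mul_assoc, ← mul_assoc,
      ← mul_assoc, S.gxy k j, add_mul, smul_mul_assoc]
  have hPx : ∀ k, P * S.gx k = S.gx k * P - h • (S.gx k * Q) + h • (S.gy k * P) +
      h ^ 2 • (S.gy k * Q) := fun k => by
    have h1 : (S.gy j)⁻¹ * S.gx k = S.gx k * (S.gy j)⁻¹ + h • (S.gy k * (S.gy j)⁻¹) := by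
      rw [S.gx_mul_inv, S.inv_mul_gy]; abel
    rw [hP, hQ, add_mul, mul_assoc, (hs _).eq, ← mul_assoc, S.gxx k j, mul_assoc _ r, (hr _).eq,
      ← mul_assoc _ _ r, h1]
    simp only [add_mul, sub_mul, mul_add, mul_assoc, smul_mul_assoc]
    module
  have hxP : ∀ k, S.gx k * P = P * S.gx k - h • (P * S.gy k) + h • (Q * S.gx k) +
      h ^ 2 • (Q * S.gy k) := fun k => by
    have e1 : ∀ d, P * d = S.gx j * d * s + (S.gy j)⁻¹ * d * r := fun d => by
      rw [hP, add_mul, mul_assoc, (hs _).eq, mul_assoc _ r, (hr _).eq, mul_assoc, mul_assoc]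
    have e2 : ∀ d, Q * d = S.gy j * d * s := fun d => by
      rw [hQ, mul_assoc, (hs _).eq, mul_assoc]
    rw [e1, e1, e2, e2, hP, mul_add, ← mul_assoc, ← mul_assoc, S.gxx j k, S.gx_mul_inv]
    simp only [add_mul, sub_mul, mul_assoc, smul_mul_assoc]
    module
  obtain ⟨δ, hδ, hδx, hδy⟩ := S.exists_derivation_HAlg (fun i => if i = o then P else 0)
    (fun i => if i = o then Q else 0)
    (fun i k => by split_ifs <;> simp [hQy]) (fun i k => by split_ifs <;> simp [hPy])
    (fun i k => by split_ifs <;> simp [hxQ])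
    (fun i k => by
      split_ifs
      · exact hPx k
      · simp)
    (fun i k => by
      split_ifs
      · exact hxP k
      · simp)
  have hδ1 : δ 1 = 0 := by simpa using hδ 1 1
  have hδj : δ (HAlg.y j) = 0 := by simp [hδy, hj]
  have hδpow : ∀ n, δ (HAlg.y j ^ n) = 0 := by
    intro n
    induction n with
    | zero => simpa using hδ1
    | succ n ih => rw [pow_succ, hδ, ih, hδj, zero_mul, mul_zero, add_zero]
  have hιpow : ∀ n, S.ι (HAlg.y j ^ n) = S.gy j ^ n := fun n => by rw [map_pow]; rfl
  let K := Subring.center D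
  have hK : ∀ (k : K) (d : D), d * k = k * d := fun k d => Subring.mem_center_iff.1 k.2 d
  have : CharZero D := charZero_of_injective_algebraMap (algebraMap ℂ D).injective
  have : CharZero K := (Subring.subtype K).charZero
  -- `z.fst ↦ z.snd` is induced by `δ`
  let R : Subring (DualNumber K) :=
    { carrier := {z | ∃ N a, S.ι a = (z.fst : D) * S.gy j ^ N ∧ δ a = (z.snd : D) * S.gy j ^ N}
      zero_mem' := ⟨0, 0, by simp, by simp⟩
      one_mem' := ⟨0, 1, by simp, by simp [hδ1]⟩
      neg_mem' := by
        rintro z ⟨N, a, h1, h2⟩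
        exact ⟨N, -a, by simp [h1], by simp [h2]⟩
      add_mem' := by
        rintro z z' ⟨N, a, h1, h2⟩ ⟨N', a', h1', h2'⟩
        refine ⟨N + N', a * HAlg.y j ^ N' + a' * HAlg.y j ^ N, ?_, ?_⟩
        · rw [map_add, map_mul, map_mul, h1, h1', hιpow, hιpow, mul_assoc, mul_assoc, ← pow_add,
            ← pow_add, add_comm N', ← add_mul]
          rfl
        · rw [map_add, hδ, hδ, hδpow, hδpow, h2, h2', hιpow, hιpow, mul_zero, mul_zero, add_zero,
            add_zero, mul_assoc, mul_assoc, ← pow_add, ← pow_add, add_comm N', ← add_mul]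
          rfl
      mul_mem' := by
        rintro z z' ⟨N, a, h1, h2⟩ ⟨N', a', h1', h2'⟩
        have e : ∀ k k' : K, (k : D) * S.gy j ^ N * (k' * S.gy j ^ N') =
            k * k' * S.gy j ^ (N + N') := fun k k' => by
          rw [mul_assoc, ← mul_assoc _ (k' : D), hK k', pow_add]
          simp only [mul_assoc]
        refine ⟨N + N', a * a', ?_, ?_⟩
        · rw [map_mul, h1, h1', e]
          rfl
        · rw [hδ, h1, h1', h2, h2', e, e, ← add_mul]
          congr 1
          rw [TrivSqZeroExt.snd_mul]
          change (z.snd : D) * z'.fst + z.fst * z'.snd = z.fst * z'.snd + z.snd * z'.fst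
          abel }
  have hRmem : ∀ (k e : K) N a, S.ι a = (k : D) * S.gy j ^ N → δ a = (e : D) * S.gy j ^ N →
      (TrivSqZeroExt.inl k + TrivSqZeroExt.inr e : DualNumber K) ∈ R :=
    fun k e N a h1 h2 => ⟨N, a, by simpa using h1, by simpa using h2⟩
  -- The relation `R` is single-valued: first component zero gives `ι a = 0`, so `a = 0` and `δ a =
  -- 0`. The resulting `d` is defined on the whole centre, including the roots.
  obtain ⟨d, hd, hdR⟩ := exists_derivation_of_graph R (by
    rintro z ⟨N, a, h1, h2⟩ hz
    rw [hz, ZeroMemClass.coe_zero, zero_mul] at h1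
    have ha : a = 0 := S.ι_injective (by rw [h1, map_zero])
    rw [ha, map_zero] at h2
    have h3 := (mul_eq_zero.1 h2.symm).resolve_right (pow_ne_zero _ h0)
    exact TrivSqZeroExt.ext hz (Subtype.ext h3))
  have hdval : ∀ (k e : K) N a, S.ι a = (k : D) * S.gy j ^ N → δ a = (e : D) * S.gy j ^ N →
      d k = e := fun k e N a h1 h2 => by
    simpa using hdR _ (hRmem k e N a h1 h2)
  let toK : ∀ z : D, (∀ d, Commute z d) → K :=
    fun z hz => ⟨z, Subring.mem_center_iff.2 fun d => (hz d).symm⟩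
  have hdc : ∀ c : ℂ, d (toK (algebraMap ℂ D c) fun d => Algebra.commutes c d) = 0 := fun c =>
    hdval _ 0 0 (algebraMap ℂ _ c) (by simp [toK])
      (by rw [Algebra.algebraMap_eq_smul_one, map_smul, hδ1]; simp)
  have hdu : ∀ i, d (toK _ (S.ratio_commute j i)) = if i = o then toK s hs else 0 := fun i => by
    refine hdval _ _ 1 (HAlg.y i) ?_ ?_
    · rw [pow_one]; exact (S.ratio_mul j i).symm
    · rw [hδy, pow_one]
      split_ifs
      · exact (hs _).symm.eq
      · simp
  have hdd : ∀ i, d (toK _ (S.det_commute j i)) = if i = o then toK r hr else 0 := fun i => by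
    refine hdval _ _ 0 (HAlg.y j * HAlg.x i - HAlg.y i * HAlg.x j) ?_ ?_
    · simp only [map_sub, map_mul, pow_zero, mul_one]; rfl
    · rw [map_sub, hδ, hδ, hδj, hδx, hδx, hδy, if_neg hj]
      change 0 * S.gx i + S.gy j * _ - (_ * S.gx j + S.gy i * 0) = _
      split_ifs
      · simp only [hP, hQ, mul_add, mul_inv_cancel_left₀ h0, toK, pow_zero, mul_one, mul_zero,
          zero_mul, zero_add, add_zero]
        rw [mul_assoc _ s, (hs _).eq]
        abel
      · simp
  let w : D := (S.gy j)⁻¹ * S.gx j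
  have hw : S.gy j * w = S.gx j := mul_inv_cancel_left₀ h0 _
  let c : K := toK (algebraMap ℂ D h) fun d => Algebra.commutes h d
  have hc : c ≠ 0 := fun hc => hh ((algebraMap ℂ D).injective
    ((congrArg Subtype.val hc).trans (map_zero _).symm))
  have hwy : w * S.gy j = S.gy j * w + c • S.gy j := by
    rw [hw]
    change (S.gy j)⁻¹ * S.gx j * S.gy j = S.gx j + algebraMap ℂ D h * S.gy j
    rw [mul_assoc, S.gxy, mul_add, inv_mul_cancel_left₀ h0, mul_smul_comm, inv_mul_cancel_left₀ h0,
      Algebra.smul_def]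
  have hyi : ∀ i, S.gy i = S.gy j * (toK _ (S.ratio_commute j i) : K) := fun i =>
    (mul_inv_cancel_left₀ h0 _).symm
  have hxi : ∀ i, S.gy j * S.gx i = (toK _ (S.det_commute j i) : K) + S.gy i * S.gx j := fun i => by
    change _ = S.gy j * S.gx i - S.gy i * S.gx j + _
    abel
  -- Each `y_i` is `y_j` times a central ratio, and each `x_i` is recovered from the central `y_j
  -- x_i - y_i x_j`.
  have hgen : Subfield.closure (Set.range (algebraMap K D) ∪ {w, S.gy j}) = ⊤ := by
    set T := Subfield.closure (Set.range (algebraMap K D) ∪ {w, S.gy j}) with hT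
    have hKT : ∀ k : K, (k : D) ∈ T := fun k => Subfield.subset_closure (Or.inl ⟨k, rfl⟩)
    have hwT : w ∈ T := Subfield.subset_closure (Or.inr (Or.inl rfl))
    have hyT : S.gy j ∈ T := Subfield.subset_closure (Or.inr (Or.inr rfl))
    have hyiT : ∀ i, S.gy i ∈ T := fun i => by
      rw [hyi i]; exact mul_mem hyT (hKT _)
    rw [eq_top_iff]
    rintro a -
    refine S.induction (P := fun a => a ∈ T)
      (fun c => hKT (toK _ fun d => Algebra.commutes c d)) (fun i => ?_) hyiT
      (fun s hs => hKT (toK s (S.roots_central s hs))) (fun _ _ => add_mem)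
      (fun _ _ => mul_mem) (fun _ _ => inv_mem) a
    have : S.gx i = (S.gy j)⁻¹ * ((toK _ (S.det_commute j i) : K) + S.gy i * S.gx j) := by
      rw [← hxi, inv_mul_cancel_left₀ h0]
    rw [this, ← hw]
    exact mul_mem (inv_mem hyT) (add_mem (hKT _) (mul_mem (hyiT i) (mul_mem hyT hwT)))
  obtain ⟨Δ, hΔ, hΔK, hΔw, hΔy⟩ := exists_derivation_of_shift hc h0 hwy hgen d hd (hdc h)
  have hΔK' : ∀ k : K, Δ k = d k := hΔK
  have hΔc : ∀ c : ℂ, Δ (algebraMap ℂ D c) = 0 := fun c =>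
    (hΔK' (toK _ fun d => Algebra.commutes c d)).trans (by rw [hdc]; rfl)
  have hΔyi : ∀ i, Δ (S.gy i) = if i = o then Q else 0 := fun i => by
    rw [hyi i, hΔ, hΔy, hΔK', hdu]
    split_ifs <;> simp [toK, hQ]
  have hΔxj : Δ (S.gx j) = 0 := by rw [← hw, hΔ, hΔy, hΔw, zero_mul, mul_zero, add_zero]
  have hΔxi : ∀ i, Δ (S.gx i) = if i = o then P else 0 := fun i => by
    have h1 := congrArg Δ (hxi i)
    rw [hΔ, hΔy, map_add, hΔ, hΔxj, hΔyi, hΔK', hdd] at h1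
    refine mul_left_cancel₀ h0 ?_
    rw [zero_mul, zero_add] at h1
    rw [h1]
    split_ifs
    · simp only [hP, hQ, mul_add, mul_inv_cancel_left₀ h0, toK, mul_zero, add_zero]
      rw [mul_assoc _ s, (hs _).eq]
      abel
    · simp
  refine ⟨{ Δ with
    map_smul' := fun c a => ?_ }, ⟨hΔ, ?_, ?_, ?_⟩⟩
  · change Δ (c • a) = c • Δ a
    rw [Algebra.smul_def, hΔ, hΔc, zero_mul, zero_add, Algebra.smul_def]
  · exact (hΔxi o).trans (if_pos rfl)
  · exact (hΔyi o).trans (if_pos rfl)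
  -- The choice of `d` on the roots is not controlled directly; their algebraicity forces the value
  -- zero.
  · exact fun a ha => S.derivation_coeffs hΔ hΔc (fun i hi => (hΔxi i).trans (if_neg hi))
      (fun i hi => (hΔyi i).trans (if_neg hi)) ha

end CentralExt

/-! ### Homogeneous expressions -/

section Homogeneous

variable {K D : Type*} [Field K] [DivisionRing D] [Algebra K D]

/-- A product of `n` factors `a • P + b • Q` is a form of degree `n` in the central variables
`a, b`. -/
theorem exists_homogeneous_step (P Q : D) {n : ℕ} {f : K → K → D}
    (hf : ∃ B : ℕ → D, ∀ a b, f a b = ∑ p ∈ Finset.range (n + 1), (a ^ p * b ^ (n - p)) • B p) :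
    ∃ B : ℕ → D, ∀ a b, (a • P + b • Q) * f a b =
      ∑ p ∈ Finset.range (n + 1 + 1), (a ^ p * b ^ (n + 1 - p)) • B p := by
  obtain ⟨B, hB⟩ := hf
  refine ⟨fun p => (if p = 0 then 0 else P * B (p - 1)) + if p ≤ n then Q * B p else 0,
    fun a b => ?_⟩
  rw [hB, add_mul, Finset.mul_sum, Finset.mul_sum]
  simp only [smul_add, Finset.sum_add_distrib]
  congr 1
  · rw [Finset.sum_range_succ' _ (n + 1), if_pos rfl, smul_zero, add_zero]
    refine Finset.sum_congr rfl fun p _ => ?_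
    rw [if_neg (Nat.succ_ne_zero p), smul_mul_smul_comm, Nat.add_sub_cancel, Nat.add_sub_add_right,
      pow_succ']
    simp only [mul_assoc]
  · rw [Finset.sum_range_succ _ (n + 1), if_neg (by omega), smul_zero, add_zero]
    refine Finset.sum_congr rfl fun p hp => ?_
    have hp' : p ≤ n := by simpa [Nat.lt_succ_iff] using hp
    rw [if_pos hp', smul_mul_smul_comm, Nat.succ_sub hp', pow_succ']
    congr 1
    ring

theorem exists_homogeneous_monomial (P Q P' Q' A : D) (m l : ℕ) :
    ∃ B : ℕ → D, ∀ a b : K, (a • P + b • Q) ^ m * (a • P' + b • Q') ^ l * A =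
      ∑ p ∈ Finset.range (m + l + 1), (a ^ p * b ^ (m + l - p)) • B p := by
  induction m with
  | zero =>
    simp only [zero_add, pow_zero, one_mul]
    induction l with
    | zero => exact ⟨fun _ => A, by simp⟩
    | succ l ih =>
      obtain ⟨B, hB⟩ := exists_homogeneous_step P' Q' ih
      exact ⟨B, fun a b => by rw [← hB, pow_succ', mul_assoc]⟩
  | succ m ih =>
    obtain ⟨B, hB⟩ := exists_homogeneous_step P Q ih
    refine ⟨B, fun a b => ?_⟩
    rw [Nat.succ_add, ← hB, pow_succ']
    simp only [mul_assoc]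

/-- The point is that the `B p` do not depend on `a, b`, so sums over several points can be taken
coefficient by coefficient. -/
theorem exists_homogeneous_form (P Q P' Q' : D) (n : ℕ) (A : ℕ → D) :
    ∃ B : ℕ → D, ∀ a b : K, ∑ i ∈ Finset.range (n + 1),
        n.choose i • ((a • P + b • Q) ^ (n - i) * (a • P' + b • Q') ^ i * A i) =
      ∑ p ∈ Finset.range (n + 1), (a ^ p * b ^ (n - p)) • B p := by
  choose B hB using fun i => exists_homogeneous_monomial (K := K) P Q P' Q' (A i) (n - i) i
  refine ⟨fun p => ∑ i ∈ Finset.range (n + 1), n.choose i • B i p, fun a b => ?_⟩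
  simp only [Finset.smul_sum]
  rw [Finset.sum_comm]
  refine Finset.sum_congr rfl fun i hi => ?_
  have hin : n - i + i = n := Nat.sub_add_cancel (by simpa [Nat.lt_succ_iff] using hi)
  rw [hB, hin, Finset.smul_sum]
  exact Finset.sum_congr rfl fun p _ => smul_comm _ _ _

end Homogeneous

theorem exists_proportional {K : Type*} [Field K] {a b a' b' : K} (hab : ¬(a = 0 ∧ b = 0))
    (hab' : ¬(a' = 0 ∧ b' = 0)) (hdet : a * b' - b * a' = 0) :
    ∃ c : K, c ≠ 0 ∧ a' = c * a ∧ b' = c * b := by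
  by_cases ha : a = 0
  · have hb : b ≠ 0 := fun hb => hab ⟨ha, hb⟩
    have ha' : a' = 0 := by simpa [ha, hb] using hdet
    refine ⟨b' / b, div_ne_zero (fun hb' => hab' ⟨ha', hb'⟩) hb, by simp [ha, ha'], ?_⟩
    rw [div_mul_cancel₀ _ hb]
  · have e : b' = a' / a * b := by
      rw [div_mul_eq_mul_div, eq_div_iff ha]
      linear_combination hdet
    refine ⟨a' / a, fun h0 => hab' ?_, (div_mul_cancel₀ _ ha).symm, e⟩
    rw [h0, zero_mul] at e
    exact ⟨(div_eq_zero_iff.1 h0).resolve_right ha, e⟩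

namespace CentralExt

variable {h : ℂ} {I : Type*} [LinearOrder I] {o : I} {D : Type*} [DivisionRing D] [Algebra ℂ D]
  (S : CentralExt h o D)

/-! ### Polarization -/

section Polarization

variable {Δ : D →ₗ[ℂ] D}

theorem pow_succ_apply_mul (hΔ : ∀ a b, Δ (a * b) = Δ a * b + a * Δ b) {v : D}
    (hv : Δ (Δ v) = 0) (f : D) (n : ℕ) : (Δ ^ (n + 1)) (v * f) =
      v * (Δ ^ (n + 1)) f + (n + 1) • (Δ v * (Δ ^ n) f) := by
  induction n with
  | zero => simp [hΔ, add_comm]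
  | succ n ih =>
    rw [pow_succ' Δ (n + 1), Module.End.mul_apply, ih, map_add, map_nsmul, hΔ, hΔ, hv, zero_mul,
      zero_add, ← Module.End.mul_apply, ← pow_succ', ← Module.End.mul_apply Δ (Δ ^ n), ← pow_succ',
      succ_nsmul _ (n + 1)]
    abel

theorem pow_apply_mul_of_linear (hΔ : ∀ a b, Δ (a * b) = Δ a * b + a * Δ b) {v f e : D}
    (hv : Δ (Δ v) = 0) {n : ℕ} (hf : (Δ ^ n) f = n.factorial • e) (he : Δ e = 0) :
    (Δ ^ (n + 1)) (v * f) = (n + 1).factorial • (Δ v * e) ∧ Δ (Δ v * e) = 0 := by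
  refine ⟨?_, by rw [hΔ, hv, he, zero_mul, mul_zero, add_zero]⟩
  rw [pow_succ_apply_mul hΔ hv, pow_succ', Module.End.mul_apply, hf, map_nsmul, he, nsmul_zero,
    mul_zero, zero_add, mul_smul_comm, Nat.factorial_succ, mul_smul]

/-- Each application of `Δ` replaces one letter in place and the new letters are constants; all `m +
l` letters are replaced, in `(m + l)!` orders. -/
theorem pow_apply_monomial {X Y : D} (hΔ : S.IsPolarDer X Y Δ) (hX : Δ X = 0) (hY : Δ Y = 0)
    {A : D} (hA : Δ A = 0) (m l : ℕ) :
    (Δ ^ (m + l)) (S.x ^ m * S.y ^ l * A) = (m + l).factorial • (X ^ m * Y ^ l * A) := by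
  suffices H : (Δ ^ (m + l)) (S.x ^ m * S.y ^ l * A) = (m + l).factorial • (X ^ m * Y ^ l * A) ∧
      Δ (X ^ m * Y ^ l * A) = 0 from H.1
  have hx := hΔ.map_x
  have hy := hΔ.map_y
  induction m with
  | zero =>
    simp only [zero_add, pow_zero, one_mul]
    induction l with
    | zero => simp [hA]
    | succ l ih =>
      have := pow_apply_mul_of_linear hΔ.leibniz (v := S.y) (by rw [hy, hY]) ih.1 ih.2
      rwa [hy, ← mul_assoc, ← mul_assoc, ← pow_succ', ← pow_succ'] at this
  | succ m ih =>
    have := pow_apply_mul_of_linear hΔ.leibniz (v := S.x) (by rw [hx, hX]) ih.1 ih.2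
    rw [hx] at this
    simp only [← mul_assoc, ← pow_succ'] at this
    rwa [Nat.succ_add]

theorem polar_eq_pow (X Y : D) (n : ℕ) : ∀ a, S.polar X Y n n a =
    (n.factorial : ℂ)⁻¹ • (S.polarDer X Y ^ n) a := by
  induction n with
  | zero => intro a; simp [polar]
  | succ n ih =>
    intro a
    rw [polar, Nat.add_sub_cancel, ih, map_smul, smul_smul, pow_succ, Module.End.mul_apply,
      Nat.factorial_succ]
    push_cast
    rw [mul_inv_rev]

/-- Polarizing a form completely means evaluating it at the point. -/
theorem polar_form {X Y : D} (hX : X ∈ S.coeffs) (hY : Y ∈ S.coeffs)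
    (hex : ∃ Δ, S.IsPolarDer X Y Δ) (n : ℕ) (A : ℕ → D) (hA : ∀ i, A i ∈ S.coeffs) :
    S.polar X Y n n (∑ i ∈ Finset.range (n + 1), n.choose i • (S.x ^ (n - i) * S.y ^ i * A i)) =
      ∑ i ∈ Finset.range (n + 1), n.choose i • (X ^ (n - i) * Y ^ i * A i) := by
  have hΔ : S.IsPolarDer X Y (S.polarDer X Y) := by
    rw [polarDer, dif_pos hex]
    exact hex.choose_spec
  rw [polar_eq_pow, map_sum, Finset.smul_sum]
  refine Finset.sum_congr rfl fun i hi => ?_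
  have hin : n - i + i = n := Nat.sub_add_cancel (by simpa [Nat.lt_succ_iff] using hi)
  have := S.pow_apply_monomial hΔ (hΔ.map_coeffs _ hX) (hΔ.map_coeffs _ hY)
    (hΔ.map_coeffs _ (hA i)) (n - i) i
  rw [hin] at this
  rw [map_nsmul, this, smul_comm, ← Nat.cast_smul_eq_nsmul ℂ n.factorial, smul_smul,
    inv_mul_cancel₀ (by exact_mod_cast n.factorial_ne_zero), one_smul]

end Polarization

/-! ### Points -/

/-- Were `o` the only index, all coefficients would be central. Commuting the central element `(0X)`
with `y` would give `h y² Y = 0`, then with `x` would give `h y² X = 0`, so `(0X) = 0`. -/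
theorem IsPoint.exists_ne {X Y : D} (hh : h ≠ 0) (hXY : S.IsPoint X Y) : ∃ j, j ≠ o := by
  by_contra hall
  push Not at hall
  have hcen : ∀ a ∈ S.coeffs, ∀ d, Commute a d := fun a ha =>
    S.coeffs_induction (P := fun a => ∀ d, Commute a d) (fun c d => Algebra.commutes c d)
      (fun i hi => absurd (hall i) hi) (fun i hi => absurd (hall i) hi)
      (fun s hs => S.roots_central s hs) (fun a b ha hb d => (ha d).add_left (hb d))
      (fun a b ha hb d => (ha d).mul_left (hb d)) (fun a _ ha d => (ha d).inv_left₀) a ha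
  obtain ⟨hX, hY, hne, hinv, -⟩ := hXY
  have hc := Inv.commute S hinv
  have hy0 : S.y ≠ 0 := S.gy_ne_zero o
  have hxy : S.x * S.y = S.y * S.x + h • (S.y * S.y) := S.gxy o o
  have hY0 : Y = 0 := by
    have h1 := (hc S.y).eq
    have h2 : h • (S.y * S.y * Y) = 0 := by
      simp only [bracket, sub_mul, mul_sub, smul_mul_assoc, mul_smul_comm, mul_assoc,
        (hcen X hX S.y).eq, (hcen Y hY S.y).eq] at h1
      rw [← mul_assoc S.x, hxy, add_mul] at h1
      simp only [mul_assoc, smul_mul_assoc] at h1 ⊢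
      have h3 := sub_eq_zero.2 h1
      rw [← h3]
      abel
    simpa [hh, hy0] using h2
  subst hY0
  have hX0 : X = 0 := by
    have h1 := (hc S.x).eq
    have h2 : h • (S.y * S.y * X) = 0 := by
      simp only [bracket, mul_zero, zero_sub, smul_zero, sub_zero, neg_mul, mul_neg, mul_assoc,
        (hcen X hX S.x).eq, neg_inj] at h1
      rw [← mul_assoc S.x, hxy, add_mul] at h1
      simp only [mul_assoc, smul_mul_assoc] at h1 ⊢
      exact (left_eq_add.1 h1)
    simpa [hh, hy0] using h2
  subst hX0
  exact hne (by simp [bracket])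

/-- Brackets with a point on the line spanned by `(x_j, y_j)` and `(y_j⁻¹, 0)`. -/
theorem bracket_eq (j : I) {s r : D} (hs : ∀ d, Commute s d) (hr : ∀ d, Commute r d) (X Y : D) :
    bracket h (S.gx j * s + (S.gy j)⁻¹ * r) (S.gy j * s) X Y =
      bracket h (S.gx j) (S.gy j) X Y * s + (S.gy j)⁻¹ * Y * r := by
  simp only [bracket, add_mul, sub_mul, smul_mul_assoc]
  rw [mul_assoc _ s Y, (hs Y).eq, mul_assoc _ r Y, (hr Y).eq, mul_assoc _ s X, (hs X).eq,
    mul_assoc _ s Y, (hs Y).eq]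
  simp only [mul_assoc]
  abel

/-- The central parameters of a point with respect to `(x_j, y_j)` and `(y_j⁻¹, 0)`. -/
theorem IsPoint.central {X Y : D} (hh : h ≠ 0) (hXY : S.IsPoint X Y) {j : I} (hj : j ≠ o) :
    (∀ d, Commute (bracket h (S.gx j) (S.gy j) X Y) d) ∧ (∀ d, Commute ((S.gy j)⁻¹ * Y) d) := by
  obtain ⟨hX, hY, -, hinv, -⟩ := hXY
  have hc := Inv.commute S hinv
  -- The derivative of the central element `(0X)` is the bracket of the new point with `(X, Y)`,
  -- hence central; `(s, r) = (1, 0)` and `(0, 1)` isolate the two parameters.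
  have key : ∀ s r : D, (∀ d, Commute s d) → (∀ d, Commute r d) → ∀ d,
      Commute (bracket h (S.gx j) (S.gy j) X Y * s + (S.gy j)⁻¹ * Y * r) d := by
    intro s r hs hr
    obtain ⟨Δ, hΔ⟩ := S.exists_isPolarDer hh hj hs hr
    rw [← S.bracket_eq j hs hr]
    have h1 : Δ (bracket h S.x S.y X Y) =
        bracket h (S.gx j * s + (S.gy j)⁻¹ * r) (S.gy j * s) X Y := by
      simp only [bracket, map_sub, map_smul, hΔ.leibniz, hΔ.map_x, hΔ.map_y, hΔ.map_coeffs X hX,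
        hΔ.map_coeffs Y hY, mul_zero, add_zero]
    rw [← h1]
    exact derivation_commute (Δ := Δ.toAddMonoidHom) hΔ.leibniz hc
  constructor
  · simpa using key 1 0 Commute.one_left Commute.zero_left
  · simpa using key 0 1 Commute.zero_left Commute.one_left

theorem point_eq (j : I) (X Y : D) :
    X = S.gx j * ((S.gy j)⁻¹ * Y) + (S.gy j)⁻¹ * -bracket h (S.gx j) (S.gy j) X Y ∧
      Y = S.gy j * ((S.gy j)⁻¹ * Y) := by
  have h0 := S.gy_ne_zero j
  refine ⟨?_, (mul_inv_cancel_left₀ h0 Y).symm⟩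
  rw [← mul_assoc, S.gx_mul_inv, inv_mul_cancel₀ h0, bracket]
  simp only [sub_mul, mul_neg, mul_sub, smul_mul_assoc, one_mul, mul_smul_comm,
    inv_mul_cancel_left₀ h0, mul_assoc]
  abel

theorem zero_smul_eq {K : Type*} [Field K] [Algebra K D] {c : K} (hc : c ≠ 0) (X Y : D) :
    zero h (c • X) (c • Y) = zero h X Y := by
  have : (c • Y)⁻¹ = c⁻¹ • Y⁻¹ := by
    rw [Algebra.smul_def, mul_inv_rev, Algebra.smul_def, ← map_inv₀, Algebra.commutes]
  rw [zero, zero, this, smul_mul_smul_comm, mul_inv_cancel₀ hc, one_smul]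

end CentralExt

/-! ### Reduction to interpolation over the centre -/

theorem lemma24 {I : Type*} [LinearOrder I] (o : I) (h : ℂ) (hh : h ≠ 0)
    {D : Type*} [DivisionRing D] [Algebra ℂ D] (S : CentralExt h o D)
    (k : ℕ) (hk : 2 ≤ k) (X Y : Fin k → D) (hXY : ∀ i, S.IsPoint (X i) (Y i))
    (hZ : ∀ i j, i ≠ j → CentralExt.zero h (X i) (Y i) ≠ CentralExt.zero h (X j) (Y j))
    (g : D) (hg : S.IsForm (k - 2) g) :
    ∑ i : Fin k, S.polar (X i) (Y i) (k - 2) (k - 2) g /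
      (((List.finRange k).filter (fun j => j ≠ i)).map
        (fun j => CentralExt.bracket h (X i) (Y i) (X j) (Y j))).prod = 0 := by
  obtain ⟨j, hj⟩ := (hXY ⟨0, by omega⟩).exists_ne S hh
  let K := Subring.center D
  -- coordinates of the points over the center
  let b : Fin k → K := fun i => ⟨(S.gy j)⁻¹ * Y i,
    Subring.mem_center_iff.2 fun d => (((hXY i).central S hh hj).2 d).symm⟩
  let a : Fin k → K := fun i => -⟨CentralExt.bracket h (S.gx j) (S.gy j) (X i) (Y i),
    Subring.mem_center_iff.2 fun d => (((hXY i).central S hh hj).1 d).symm⟩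
  have hK : ∀ (k : K) (d : D), Commute (k : D) d := fun k d =>
    (Subring.mem_center_iff.1 k.2 d).symm
  have hX : ∀ i, X i = S.gx j * b i + (S.gy j)⁻¹ * a i := fun i => (S.point_eq j (X i) (Y i)).1
  have hY : ∀ i, Y i = S.gy j * b i := fun i => (S.point_eq j (X i) (Y i)).2
  have hX' : ∀ i, X i = a i • (S.gy j)⁻¹ + b i • S.gx j := fun i => by
    rw [hX, ← (hK (b i) _).eq, ← (hK (a i) _).eq, add_comm]; rfl
  have hY' : ∀ i, Y i = a i • (0 : D) + b i • S.gy j := fun i => by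
    rw [hY, ← (hK (b i) _).eq, smul_zero, zero_add]; rfl
  have hbr : ∀ i l, CentralExt.bracket h (X i) (Y i) (X l) (Y l) =
      ((a i * b l - b i * a l : K) : D) := fun i l => by
    have e1 : CentralExt.bracket h (S.gx j) (S.gy j) (X l) (Y l) = -(a l : D) := by
      simp [a]
    have e2 : (S.gy j)⁻¹ * Y l = b l := rfl
    rw [hX i, hY i, S.bracket_eq j (hK _) (hK _), e1, e2]
    push_cast
    rw [(hK (a i) _).eq, (hK (b i) _).eq]
    noncomm_ring
  have hab : ∀ i, ¬(a i = 0 ∧ b i = 0) := by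
    rintro i ⟨h1, h2⟩
    refine (hXY i).2.2.1 ?_
    have e1 : X i = 0 := by rw [hX', h1, h2]; simp
    have e2 : Y i = 0 := by rw [hY', h2]; simp
    simp [e1, e2, CentralExt.bracket]
  -- A vanishing determinant makes the points proportional by a central factor, which cancels in `X
  -- Y⁻¹`; with `Y = 0` both inverses are zero and the argument persists.
  have hdet : ∀ i ∈ Finset.univ, ∀ l ∈ Finset.univ, i ≠ l → a i * b l - b i * a l ≠ 0 := by
    intro i _ l _ hil h0
    obtain ⟨c, hc, h1, h2⟩ := exists_proportional (hab i) (hab l) h0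
    refine hZ i l hil ?_
    have e1 : X l = c • X i := by rw [hX', hX' i, h1, h2, smul_add, smul_smul, smul_smul]
    have e2 : Y l = c • Y i := by rw [hY', hY' i, h2]; simp [mul_smul]
    rw [e1, e2, CentralExt.zero_smul_eq hc]
  obtain ⟨-, -, A, hA, rfl⟩ := hg
  obtain ⟨B, hB⟩ := exists_homogeneous_form (K := K) (S.gy j)⁻¹ (S.gx j) 0 (S.gy j)
    (k - 2) A
  have hpolar : ∀ i, S.polar (X i) (Y i) (k - 2) (k - 2)
      (∑ m ∈ Finset.range (k - 2 + 1), (k - 2).choose m • (S.x ^ (k - 2 - m) * S.y ^ m * A m)) =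
      ∑ p ∈ Finset.range (k - 2 + 1), (a i ^ p * b i ^ (k - 2 - p)) • B p := fun i => by
    rw [S.polar_form (hXY i).1 (hXY i).2.1 ?_ _ A hA, hX' i, hY' i, hB]
    rw [hX i, hY i]
    exact S.exists_isPolarDer hh hj (hK _) (hK _)
  -- The brackets lie in `K`, so the ordered product over the list is a product over a finset.
  have hprod : ∀ i, (((List.finRange k).filter (fun l => l ≠ i)).map
      (fun l => CentralExt.bracket h (X i) (Y i) (X l) (Y l))).prod =
      ((∏ l ∈ Finset.univ.erase i, (a i * b l - b i * a l) : K) : D) := fun i => by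
    have e : (fun l => CentralExt.bracket h (X i) (Y i) (X l) (Y l)) =
        (Subring.subtype K) ∘ fun l => a i * b l - b i * a l := funext fun l => hbr i l
    rw [e, ← List.map_map, ← map_list_prod]
    change ((_ : K) : D) = _
    congr 1
    have e' : (Finset.univ.erase i : Finset (Fin k)) =
        ((List.finRange k).filter (fun l => l ≠ i)).toFinset := by
      ext l; simp
    rw [e', List.prod_toFinset _ ((List.nodup_finRange k).filter _)]
  calc _ = ∑ i : Fin k, ∑ p ∈ Finset.range (k - 2 + 1), (a i ^ p * b i ^ (k - 2 - p) /
        ∏ l ∈ Finset.univ.erase i, (a i * b l - b i * a l)) • B p := by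
        refine Finset.sum_congr rfl fun i _ => ?_
        rw [hpolar, hprod, Finset.sum_div]
        refine Finset.sum_congr rfl fun p _ => ?_
        set q := ∏ l ∈ Finset.univ.erase i, (a i * b l - b i * a l)
        have e : (q : D)⁻¹ = algebraMap K D q⁻¹ := (map_inv₀ (algebraMap K D) q).symm
        rw [div_eq_mul_inv, e, ← Algebra.commutes, ← Algebra.smul_def, smul_smul, mul_comm,
          ← div_eq_mul_inv]
    _ = 0 := by
        rw [Finset.sum_comm]
        refine Finset.sum_eq_zero fun p hp => ?_
        rw [← Finset.sum_smul, sum_monomial_div_prod_det_eq_zero a b p (k - 2 - p) Finset.univ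
          (by
            have := Finset.mem_range.1 hp
            rw [Finset.card_univ, Fintype.card_fin]; omega) hdet, zero_smul]
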